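/- Let $n\ge 1$ and let $f_n(z)=\sum_{j=0}^n a_j\sqrt{\binom nj}\,z^j$, where $a_0,\dots,a_n$ are i.i.d. standard complex Gaussian random variables (density $\frac1\pi e^{-|z|^2}$ with respect to Lebesgue measure on $\mathbb C$). Then almost surely $f_n$ has exactly $n$ distinct zeros $\zeta_1,\dots,\zeta_n\in\mathbb C$. Let $$\mathcal E_n=-\sum_{i\ne j}\log d_{\mathbb S^2}(\zeta_i,\zeta_j),\qquad d_{\mathbb S^2}(z,w)=\frac{2|z-w|}{\sqrt{1+|z|^2}\sqrt{1+|w|^2}},$$ the sum being over ordered pairs $(i,j)$ with $1\le i,j\le n$ and $i\neq j$, be their logarithmic energy on the sphere. Then $\mathcal E_n$ is integrable and $$\mathbb E[\mathcal E_n]=\Big(\tfrac12-\log 2\Big)n^2-\tfrac12\,n\log n-\Big(\tfrac12-\log 2\Big)n .$$ -/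

import Mathlib

open MeasureTheory ProbabilityTheory

namespace EllipticEnergy

noncomputable section

/-- The standard complex Gaussian law: the measure on `ℂ` with density `π⁻¹ exp (-|z|²)` with
respect to Lebesgue measure. -/
def stdComplexGaussian : Measure ℂ :=
  volume.withDensity fun z ↦ ENNReal.ofReal (Real.pi⁻¹ * Real.exp (-‖z‖ ^ 2))

/-- The elliptic polynomial `∑ⱼ aⱼ √(n choose j) Xʲ` with coefficient vector `a`. -/
def ellipticPoly (n : ℕ) (a : Fin (n + 1) → ℂ) : Polynomial ℂ :=
  ∑ j : Fin (n + 1),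
    Polynomial.C (a j * (Real.sqrt (n.choose j) : ℂ)) * Polynomial.X ^ (j : ℕ)

/-- The zero set in `ℂ` of a (nonzero) polynomial. -/
def zeroSet (f : Polynomial ℂ) : Finset ℂ := f.roots.toFinset

/-- The spherical (chordal) distance: the Euclidean distance in `ℝ³` between the points of the
unit sphere whose stereographic projections are `z` and `w`. -/
def sphericalDist (z w : ℂ) : ℝ :=
  2 * ‖z - w‖ / (Real.sqrt (1 + ‖z‖ ^ 2) * Real.sqrt (1 + ‖w‖ ^ 2))

/-- The logarithmic energy of a finite set of points, a sum over ordered pairs of distinct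
points. -/
def logEnergy (Z : Finset ℂ) : ℝ :=
  -∑ p ∈ Z.offDiag, Real.log (sphericalDist p.1 p.2)

end

end EllipticEnergy

/-! ### Linear functionals of complex Gaussian vectors, and Gaussian tilting -/

namespace EllipticEnergy

/-! Write `f = a_n ∏ (X - ζ_i)`. When the zeros are simple, `f'(ζ_i) = a_n ∏_{j ≠ i} (ζ_i - ζ_j)`,
so the double sum of `log |ζ_i - ζ_j|` collapses to a single sum of `log |f'(ζ_i)|` minus `n log
|a_n|`. The energy then equals `-n(n-1) log 2 + n log |a_n|` minus the sum over zeros of `log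
|f'(ζ)| - (n-1) log (1+|ζ|²)` (`logEnergy_zeroSet`).

The expectation of such a sum over zeros comes from a Kac–Rice formula (`lintegral_zeroSum`). Freeze
all coefficients except `a_0` and put `q = f - a_0`: the zeros solve `q = -a_0`, and the area
formula for `q` (`lintegral_sum_roots`) turns the integral over `a_0` into an integral over the
plane with weight `|q'(z)|² exp(-|q(z)|²) / π`. Averaging over the other coefficients is a Gaussian
tilt (`lintegral_tilted_pi`). The outcome is that zeros have intensity `n / (π (1+|z|²)²)`, and at a
zero `z` the derivative is `derivDev n z` times a Gaussian `g` size-biased by `|g|²`, independent of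
`z`.

Two integrals remain: `log (1+|z|²)` has mean 1 under the uniform law on the sphere, and size
biasing raises the mean of `log |g|` by 1/2. The mean of `log |g|` itself is never computed, since
it cancels against that of `log |a_n|`. -/

lemma integral_exp_neg_norm_sq_add_re (t : ℂ) :
    ∫ z : ℂ, Complex.exp (-‖z‖ ^ 2 + ((t * z).re : ℂ) * Complex.I) =
      Real.pi * Complex.exp (-(‖t‖ ^ 2 / 4 : ℝ)) := by
  -- The real inner product of `conj t` with `z` is `Re (t z)`, whence the conjugate; the real
  -- dimension 2 gives the prefactor `π`.
  have h := GaussianFourier.integral_cexp_neg_mul_sq_norm_add (V := ℂ) (b := 1)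
    (by norm_num) Complex.I (starRingEnd ℂ t)
  have hfin : (Module.finrank ℝ ℂ : ℂ) = 2 := by simp
  rw [hfin] at h
  simp only [div_one, div_self (two_ne_zero' ℂ), Complex.cpow_one, RCLike.norm_conj,
    Complex.I_sq] at h
  convert h using 3 with z
  · rw [Complex.inner]
    simp
    ring_nf
  · push_cast
    ring_nf

lemma measurable_density :
    Measurable fun z : ℂ ↦ ENNReal.ofReal (Real.pi⁻¹ * Real.exp (-‖z‖ ^ 2)) := by
  fun_prop

lemma lintegral_stdComplexGaussian {F : ℂ → ENNReal} (hF : Measurable F) :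
    ∫⁻ z, F z ∂stdComplexGaussian =
      ∫⁻ z, ENNReal.ofReal (Real.pi⁻¹ * Real.exp (-‖z‖ ^ 2)) * F z := by
  rw [stdComplexGaussian, lintegral_withDensity_eq_lintegral_mul _ measurable_density hF]
  rfl

lemma integral_stdComplexGaussian {E : Type*} [NormedAddCommGroup E] [NormedSpace ℝ E]
    (F : ℂ → E) :
    ∫ z, F z ∂stdComplexGaussian = ∫ z, (Real.pi⁻¹ * Real.exp (-‖z‖ ^ 2)) • F z := by
  rw [stdComplexGaussian, integral_withDensity_eq_integral_toReal_smul measurable_density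
    (by simp)]
  refine integral_congr_ae (.of_forall fun z ↦ ?_)
  simp only
  rw [ENNReal.toReal_ofReal (by positivity)]

lemma stdComplexGaussian_absolutelyContinuous : stdComplexGaussian ≪ volume :=
  withDensity_absolutelyContinuous _ _

lemma integral_exp_neg_norm_sq : ∫ z : ℂ, Real.exp (-‖z‖ ^ 2) = Real.pi := by
  have h := integral_exp_neg_norm_sq_add_re 0
  have h2 : ∀ z : ℂ, Complex.exp (-‖z‖ ^ 2 + (((0 : ℂ) * z).re : ℂ) * Complex.I) =
      ((Real.exp (-‖z‖ ^ 2) : ℝ) : ℂ) := by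
    intro z; push_cast; simp
  simp_rw [h2] at h
  rw [integral_complex_ofReal] at h
  simpa using congrArg Complex.re h

lemma integrable_exp_neg_norm_sq : Integrable fun z : ℂ ↦ Real.exp (-‖z‖ ^ 2) := by
  -- A non-integrable function has integral zero by convention, whereas this integral is `π`.
  by_contra h
  have := integral_exp_neg_norm_sq
  rw [integral_undef h] at this
  exact Real.pi_ne_zero this.symm

instance : IsProbabilityMeasure stdComplexGaussian := by
  constructor
  rw [stdComplexGaussian, withDensity_apply _ MeasurableSet.univ, Measure.restrict_univ,
    ← ofReal_integral_eq_lintegral_ofReal (integrable_exp_neg_norm_sq.const_mul _)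
      (.of_forall fun z ↦ by positivity), integral_const_mul, integral_exp_neg_norm_sq,
    inv_mul_cancel₀ Real.pi_ne_zero, ENNReal.ofReal_one]

lemma integral_exp_re_mul_stdComplexGaussian (t : ℂ) :
    ∫ z : ℂ, Complex.exp (((z * t).re : ℂ) * Complex.I) ∂stdComplexGaussian =
      Complex.exp (-(‖t‖ ^ 2 / 4 : ℝ)) := by
  rw [integral_stdComplexGaussian]
  have h2 : ∀ z : ℂ, (Real.pi⁻¹ * Real.exp (-‖z‖ ^ 2)) •
      Complex.exp (((z * t).re : ℂ) * Complex.I) =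
      (Real.pi⁻¹ : ℂ) * Complex.exp (-‖z‖ ^ 2 + ((t * z).re : ℂ) * Complex.I) := by
    intro z
    rw [Complex.exp_add, Complex.real_smul, mul_comm t z]
    push_cast
    ring
  simp_rw [h2]
  rw [integral_const_mul, integral_exp_neg_norm_sq_add_re, ← mul_assoc, inv_mul_cancel₀, one_mul]
  exact_mod_cast Real.pi_ne_zero

/-- The characteristic function of a linear combination of independent Gaussians. -/
lemma integral_exp_re_sum_pi {ι : Type*} [Fintype ι] (w : ι → ℂ) :
    ∫ a : ι → ℂ, Complex.exp (((∑ j, a j * w j).re : ℂ) * Complex.I)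
        ∂Measure.pi (fun _ ↦ stdComplexGaussian) =
      Complex.exp (-((∑ j, ‖w j‖ ^ 2) / 4 : ℝ)) := by
  have h : ∀ a : ι → ℂ, Complex.exp (((∑ j, a j * w j).re : ℂ) * Complex.I) =
      ∏ j, Complex.exp (((a j * w j).re : ℂ) * Complex.I) := by
    intro a
    rw [← Complex.exp_sum, Complex.re_sum, ← Finset.sum_mul]
    push_cast
    rfl
  simp_rw [h]
  rw [integral_fintype_prod_eq_prod
    (fun j (z : ℂ) ↦ Complex.exp (((z * w j).re : ℂ) * Complex.I))]
  simp_rw [integral_exp_re_mul_stdComplexGaussian]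
  rw [← Complex.exp_sum, Finset.sum_div]
  push_cast
  rw [Finset.sum_neg_distrib]

/-- A real-linear functional on `ℂ` is the real part of multiplication by a complex number. This
brings the characteristic function of a pair into the scope of `integral_exp_re_sum_pi`. -/
lemma strongDual_prod_apply (L : StrongDual ℝ (ℂ × ℂ)) (x y : ℂ) :
    L (x, y) = (x * (L (1, 0) - L (Complex.I, 0) * Complex.I) +
      y * (L (0, 1) - L (0, Complex.I) * Complex.I)).re := by
  have h : (x, y) = x.re • ((1, 0) : ℂ × ℂ) + x.im • ((Complex.I, 0) : ℂ × ℂ) +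
      y.re • ((0, 1) : ℂ × ℂ) + y.im • ((0, Complex.I) : ℂ × ℂ) := by
    ext <;> simp
  conv_lhs => rw [h]
  simp only [map_add, map_smul, smul_eq_mul]
  simp
  ring

lemma sum_norm_sq_mul_add_mul {ι : Type*} [Fintype ι] (u v : ι → ℂ) (s t : ℂ) :
    ∑ j, ‖u j * s + v j * t‖ ^ 2 = ‖s‖ ^ 2 * ∑ j, ‖u j‖ ^ 2 + ‖t‖ ^ 2 * ∑ j, ‖v j‖ ^ 2 +
      2 * ((∑ j, u j * starRingEnd ℂ (v j)) * (s * starRingEnd ℂ t)).re := by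
  simp only [Finset.sum_mul, Finset.mul_sum, Complex.re_sum, ← Finset.sum_add_distrib]
  refine Finset.sum_congr rfl fun j _ ↦ ?_
  simp only [Complex.sq_norm, Complex.normSq_apply]
  simp
  ring

lemma charFunDual_map_pair {ι : Type*} [Fintype ι] (p q : ι → ℂ) (L : StrongDual ℝ (ℂ × ℂ)) :
    charFunDual ((Measure.pi fun _ : ι ↦ stdComplexGaussian).map
      (fun a ↦ (∑ j, a j * p j, ∑ j, a j * q j))) L =
    Complex.exp (-((∑ j, ‖p j * (L (1, 0) - L (Complex.I, 0) * Complex.I) +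
      q j * (L (0, 1) - L (0, Complex.I) * Complex.I)‖ ^ 2) / 4 : ℝ)) := by
  rw [charFunDual_apply, integral_map (Measurable.aemeasurable (by fun_prop))
    (by fun_prop), ← integral_exp_re_sum_pi]
  refine integral_congr_ae (.of_forall fun a ↦ ?_)
  simp only
  rw [strongDual_prod_apply L, Finset.sum_mul, Finset.sum_mul, ← Finset.sum_add_distrib]
  simp only [mul_add, mul_assoc]

/-- The joint law of two linear combinations of independent Gaussians depends only on the Gram
matrix of the coefficient vectors. -/
lemma map_pair_eq_of_gram {ι κ : Type*} [Fintype ι] [Fintype κ] (u v : ι → ℂ) (u' v' : κ → ℂ)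
    (hu : ∑ j, ‖u j‖ ^ 2 = ∑ j, ‖u' j‖ ^ 2) (hv : ∑ j, ‖v j‖ ^ 2 = ∑ j, ‖v' j‖ ^ 2)
    (huv : ∑ j, u j * starRingEnd ℂ (v j) = ∑ j, u' j * starRingEnd ℂ (v' j)) :
    (Measure.pi fun _ : ι ↦ stdComplexGaussian).map
        (fun a ↦ (∑ j, a j * u j, ∑ j, a j * v j)) =
      (Measure.pi fun _ : κ ↦ stdComplexGaussian).map
        (fun a ↦ (∑ j, a j * u' j, ∑ j, a j * v' j)) := by
  refine Measure.ext_of_charFunDual (funext fun L ↦ ?_)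
  rw [charFunDual_map_pair, charFunDual_map_pair, sum_norm_sq_mul_add_mul,
    sum_norm_sq_mul_add_mul, hu, hv, huv]

lemma lintegral_comp_smul_complex (F : ℂ → ENNReal) {c : ℝ} (hc : 0 < c) :
    ∫⁻ z : ℂ, F (c • z) = ENNReal.ofReal (c ^ 2)⁻¹ * ∫⁻ z, F z := by
  have h := Measure.map_addHaar_smul (volume : Measure ℂ) hc.ne'
  rw [Complex.finrank_real_complex, abs_of_pos (by positivity)] at h
  rw [← smul_eq_mul, ← lintegral_smul_measure, ← h]
  exact ((Homeomorph.smulOfNeZero c hc.ne').toMeasurableEquiv.measurableEmbedding.lintegral_map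
    F).symm

/-- Tilting a Gaussian by a Gaussian weight rescales it. -/
lemma lintegral_mul_exp_stdComplexGaussian {F : ℂ → ENNReal} (hF : Measurable F) {S : ℝ}
    (hS : 0 ≤ S) :
    ∫⁻ z, F z * ENNReal.ofReal (Real.exp (-(S * ‖z‖ ^ 2))) ∂stdComplexGaussian =
      ENNReal.ofReal (1 + S)⁻¹ *
        ∫⁻ z, F (((Real.sqrt (1 + S))⁻¹ : ℝ) • z) ∂stdComplexGaussian := by
  have hS1 : 0 < 1 + S := by positivity
  rw [lintegral_stdComplexGaussian (by fun_prop), lintegral_stdComplexGaussian (by fun_prop),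
    ← lintegral_const_mul _ (by fun_prop)]
  set c : ℝ := (Real.sqrt (1 + S))⁻¹ with hc
  have hc0 : 0 < c := by positivity
  have hc2 : (c ^ 2)⁻¹ = 1 + S := by rw [hc, inv_pow, inv_inv, Real.sq_sqrt hS1.le]
  have h := lintegral_comp_smul_complex
    (fun z ↦ ENNReal.ofReal (Real.pi⁻¹ * Real.exp (-((1 + S) * ‖z‖ ^ 2))) * F z) hc0
  rw [hc2] at h
  rw [lintegral_const_mul _ (by fun_prop)]
  have h1 : ∀ z : ℂ, ENNReal.ofReal (Real.pi⁻¹ * Real.exp (-‖z‖ ^ 2)) * F (c • z) =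
      ENNReal.ofReal (Real.pi⁻¹ * Real.exp (-((1 + S) * ‖c • z‖ ^ 2))) * F (c • z) := by
    intro z
    rw [norm_smul, Real.norm_of_nonneg hc0.le, mul_pow, ← mul_assoc, ← hc2,
      inv_mul_cancel₀ (by positivity), one_mul]
  simp_rw [h1]
  rw [h, ← mul_assoc, ← ENNReal.ofReal_mul (by positivity), inv_mul_cancel₀ hS1.ne',
    ENNReal.ofReal_one, one_mul]
  refine lintegral_congr fun z ↦ ?_
  rw [mul_left_comm, mul_comm, ← ENNReal.ofReal_mul (by positivity), mul_assoc, ← Real.exp_add]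
  ring_nf

lemma lintegral_pi_fin_two {F : ℂ → ℂ → ENNReal} (hF : Measurable (Function.uncurry F)) :
    ∫⁻ b : Fin 2 → ℂ, F (b 0) (b 1) ∂Measure.pi (fun _ ↦ stdComplexGaussian) =
      ∫⁻ y, ∫⁻ x, F x y ∂stdComplexGaussian ∂stdComplexGaussian := by
  have h := (measurePreserving_piFinTwo (fun _ : Fin 2 ↦ stdComplexGaussian)).lintegral_comp hF
  rw [lintegral_prod_symm _ hF.aemeasurable] at h
  exact h

lemma norm_sq_sum_mul_conj_le {ι : Type*} [Fintype ι] (u v : ι → ℂ) :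
    ‖∑ j, u j * starRingEnd ℂ (v j)‖ ^ 2 ≤ (∑ j, ‖u j‖ ^ 2) * ∑ j, ‖v j‖ ^ 2 := by
  refine le_trans ?_ (Finset.sum_mul_sq_le_sq_mul_sq _ _ _)
  gcongr
  refine (norm_sum_le _ _).trans_eq ?_
  simp

/-- A linear functional of a Gaussian vector tilted by the exponential of the squared modulus of
another one. -/
lemma lintegral_tilted_pi {ι : Type*} [Fintype ι] (u v : ι → ℂ) {S : ℝ} (hS : 0 < S)
    (hu : ∑ j, ‖u j‖ ^ 2 = S) {τ : ℝ}
    (hv : ∑ j, ‖v j‖ ^ 2 = τ ^ 2 + ‖∑ j, u j * starRingEnd ℂ (v j)‖ ^ 2 / (1 + S))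
    {G : ℂ → ENNReal} (hG : Measurable G) :
    ∫⁻ a : ι → ℂ, G (∑ j, a j * v j) * ENNReal.ofReal (Real.exp (-‖∑ j, a j * u j‖ ^ 2))
        ∂Measure.pi (fun _ ↦ stdComplexGaussian) =
      ENNReal.ofReal (1 + S)⁻¹ * ∫⁻ g, G (τ * g) ∂stdComplexGaussian := by
  set p : ℂ := ∑ j, u j * starRingEnd ℂ (v j) with hp
  set s : ℝ := Real.sqrt S with hs
  have hs0 : 0 < s := Real.sqrt_pos.2 hS
  have hs2 : s ^ 2 = S := Real.sq_sqrt hS.le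
  have hsc : (s : ℂ) ≠ 0 := by exact_mod_cast hs0.ne'
  set V : ℝ := ∑ j, ‖v j‖ ^ 2 with hV
  -- Cauchy–Schwarz, needed for the square root defining `β`.
  have hcs : ‖p‖ ^ 2 / S ≤ V := by
    rw [div_le_iff₀ hS, mul_comm, ← hu]
    exact norm_sq_sum_mul_conj_le u v
  -- Gram–Schmidt: the pair `u`, `v` has the same Gram matrix as `s e₀`, `α e₀ + β e₁`, so only two
  -- Gaussians matter and the tilt acts on the first alone.
  set α : ℂ := starRingEnd ℂ p / s with hα
  have hα2 : ‖α‖ ^ 2 = ‖p‖ ^ 2 / S := by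
    rw [hα, norm_div, RCLike.norm_conj, Complex.norm_of_nonneg hs0.le, div_pow, hs2]
  set β : ℝ := Real.sqrt (V - ‖p‖ ^ 2 / S) with hβ
  have hβ2 : β ^ 2 = V - ‖p‖ ^ 2 / S := Real.sq_sqrt (by linarith)
  set c : ℝ := (Real.sqrt (1 + S))⁻¹ with hc
  have hc2 : c ^ 2 = (1 + S)⁻¹ := by rw [hc, inv_pow, Real.sq_sqrt (by positivity)]
  have hlaw := map_pair_eq_of_gram u v ![(s : ℂ), 0] ![α, (β : ℂ)]
    (by simp [hu, ← hs2]) (by simp [← hV, hα2, hβ2])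
    (by simp [← hp, hα]; field_simp)
  -- The tilt shrinks the first Gaussian by `c`. Since `c²|α|² + β² = τ²`, the remaining combination
  -- has the law of `τ` times one Gaussian; the zero vectors fill the unused slot of the pair.
  have hlaw2 := map_pair_eq_of_gram (0 : Fin 2 → ℂ) ![(c : ℂ) * α, (β : ℂ)]
    (0 : Fin 1 → ℂ) ![(τ : ℂ)] (by simp)
    (by
      simp only [Fin.sum_univ_two, Fin.sum_univ_one, Matrix.cons_val_zero, Matrix.cons_val_one,
        norm_mul, mul_pow, hα2, Complex.norm_real, Real.norm_eq_abs, sq_abs, hβ2, hc2]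
      rw [hv]
      field_simp
      ring) (by simp)
  have hmeas : Measurable fun x : ℂ × ℂ ↦
      G x.2 * ENNReal.ofReal (Real.exp (-‖x.1‖ ^ 2)) := by fun_prop
  calc _ = ∫⁻ x, G x.2 * ENNReal.ofReal (Real.exp (-‖x.1‖ ^ 2))
        ∂(Measure.pi fun _ : ι ↦ stdComplexGaussian).map
          (fun a ↦ (∑ j, a j * u j, ∑ j, a j * v j)) := by
        rw [lintegral_map hmeas (by fun_prop)]
    _ = ∫⁻ b : Fin 2 → ℂ, G (b 0 * α + b 1 * β) *
          ENNReal.ofReal (Real.exp (-(S * ‖b 0‖ ^ 2)))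
          ∂Measure.pi (fun _ ↦ stdComplexGaussian) := by
        rw [hlaw, lintegral_map hmeas (by fun_prop)]
        refine lintegral_congr fun b ↦ ?_
        simp [Fin.sum_univ_two, abs_of_pos hs0, mul_pow, hs2, mul_comm S]
    _ = ∫⁻ y, ENNReal.ofReal (1 + S)⁻¹ * ∫⁻ x, G (x * (c * α) + y * β)
          ∂stdComplexGaussian ∂stdComplexGaussian := by
        rw [lintegral_pi_fin_two (F := fun x y ↦ G (x * α + y * β) *
          ENNReal.ofReal (Real.exp (-(S * ‖x‖ ^ 2)))) (by unfold Function.uncurry; fun_prop)]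
        refine lintegral_congr fun y ↦ ?_
        rw [lintegral_mul_exp_stdComplexGaussian (F := fun x ↦ G (x * α + y * β))
          (by fun_prop) hS.le]
        congr 1
        refine lintegral_congr fun x ↦ ?_
        rw [Complex.real_smul, ← hc]
        ring_nf
    _ = ENNReal.ofReal (1 + S)⁻¹ * ∫⁻ b : Fin 2 → ℂ, G (b 0 * (c * α) + b 1 * β)
          ∂Measure.pi (fun _ ↦ stdComplexGaussian) := by
        rw [lintegral_pi_fin_two (F := fun x y ↦ G (x * (c * α) + y * β))
          (by unfold Function.uncurry; fun_prop), lintegral_const_mul]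
        exact Measurable.lintegral_prod_left' (f := fun z : ℂ × ℂ ↦ G (z.1 * (c * α) + z.2 * β))
          (by fun_prop)
    _ = ENNReal.ofReal (1 + S)⁻¹ * ∫⁻ x, G x.2
          ∂(Measure.pi fun _ : Fin 1 ↦ stdComplexGaussian).map
          (fun a ↦ (∑ j, a j * (0 : Fin 1 → ℂ) j, ∑ j, a j * (![(τ : ℂ)] : Fin 1 → ℂ) j)) := by
        rw [← hlaw2, lintegral_map (by fun_prop) (by fun_prop)]
        simp [Fin.sum_univ_two]
    _ = _ := by
        rw [lintegral_map (by fun_prop) (by fun_prop)]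
        congr 1
        have h := (measurePreserving_funUnique stdComplexGaussian (Fin 1)).lintegral_comp
          (f := fun g ↦ G (τ * g)) (by fun_prop)
        rw [← h]
        simp only [Fin.sum_univ_one, Matrix.cons_val_zero, mul_comm (τ : ℂ)]
        congr!

end EllipticEnergy

/-! ### The area formula for complex polynomials -/

namespace EllipticEnergy

/-- A Suslin-type fact: a Borel map between standard Borel spaces is a measurable quotient onto its
Borel range. It yields measurability of sums over roots without choosing roots measurably. -/
lemma measurable_indicator_range {X Z : Type*} [MeasurableSpace X] [StandardBorelSpace X]
    [MeasurableSpace Z] [StandardBorelSpace Z]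
    {f : X → Z} (hf : Measurable f) (hr : MeasurableSet (Set.range f))
    {g : Z → ENNReal} (hg : Measurable (g ∘ f)) : Measurable ((Set.range f).indicator g) := by
  refine measurable_of_restrict_of_restrict_compl hr ?_ ?_
  · convert (hf.measurable_comp_iff_restrict).1 hg using 1
    funext x
    exact Set.indicator_of_mem x.2 g
  · convert (measurable_const : Measurable fun _ : ↥(Set.range f)ᶜ ↦ (0 : ENNReal)) using 1
    funext x
    exact Set.indicator_of_notMem x.2 g

lemma det_toSpanSingleton_restrictScalars (c : ℂ) :
    ((ContinuousLinearMap.toSpanSingleton ℂ c).restrictScalars ℝ).det = ‖c‖ ^ 2 := by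
  simp [ContinuousLinearMap.det, LinearMap.det_restrictScalars, Algebra.norm_complex_eq,
    Complex.sq_norm]

open Polynomial

lemma mem_roots_sub_C_toFinset {q : ℂ[X]} (hq : derivative q ≠ 0) {w ζ : ℂ} :
    ζ ∈ (q - C w).roots.toFinset ↔ q.eval ζ = w := by
  have h : q - C w ≠ 0 := by
    rintro h
    apply hq
    rw [sub_eq_zero.1 h, derivative_C]
  simp [h, sub_eq_zero]

lemma sum_roots_indicator_eval {q : ℂ[X]} (hq : derivative q ≠ 0) {s : Set ℂ}
    (hinj : Set.InjOn (fun z ↦ q.eval z) s) (G : ℂ → ENNReal) {z : ℂ} (hz : z ∈ s) :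
    ∑ ζ ∈ (q - C (q.eval z)).roots.toFinset, s.indicator G ζ = G z := by
  rw [Finset.sum_eq_single_of_mem z ((mem_roots_sub_C_toFinset hq).2 rfl),
    Set.indicator_of_mem hz]
  intro ζ hζ hne
  refine Set.indicator_of_notMem (fun hs ↦ hne ?_) _
  exact hinj hs hz ((mem_roots_sub_C_toFinset hq).1 hζ)

lemma indicator_image_sum_roots_indicator {q : ℂ[X]} (hq : derivative q ≠ 0) (s : Set ℂ)
    (G : ℂ → ENNReal) :
    ((fun z ↦ q.eval z) '' s).indicator
        (fun w ↦ ∑ ζ ∈ (q - C w).roots.toFinset, s.indicator G ζ) =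
      fun w ↦ ∑ ζ ∈ (q - C w).roots.toFinset, s.indicator G ζ := by
  rw [Set.indicator_eq_self]
  intro w hw
  by_contra hn
  refine hw (Finset.sum_eq_zero fun ζ hζ ↦ Set.indicator_of_notMem (fun hs ↦ hn ?_) _)
  exact ⟨ζ, hs, (mem_roots_sub_C_toFinset hq).1 hζ⟩

lemma hasFDerivWithinAt_eval (q : ℂ[X]) (s : Set ℂ) (z : ℂ) :
    HasFDerivWithinAt (fun z ↦ q.eval z)
      ((ContinuousLinearMap.toSpanSingleton ℂ ((derivative q).eval z)).restrictScalars ℝ) s z :=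
  ((q.hasDerivAt z).hasFDerivAt.restrictScalars ℝ).hasFDerivWithinAt

lemma measurableSet_image_eval (q : ℂ[X]) {s : Set ℂ} (hs : MeasurableSet s)
    (hinj : Set.InjOn (fun z ↦ q.eval z) s) : MeasurableSet ((fun z ↦ q.eval z) '' s) :=
  measurable_image_of_fderivWithin hs (fun z _ ↦ hasFDerivWithinAt_eval q s z) hinj

/-- The area formula for a polynomial map on a set on which it is injective. -/
lemma lintegral_sum_roots_indicator (q : ℂ[X]) (hq : derivative q ≠ 0) {s : Set ℂ}
    (hs : MeasurableSet s) (hinj : Set.InjOn (fun z ↦ q.eval z) s) (G : ℂ → ENNReal) :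
    ∫⁻ w, ∑ ζ ∈ (q - C w).roots.toFinset, s.indicator G ζ =
      ∫⁻ z in s, ENNReal.ofReal (‖(derivative q).eval z‖ ^ 2) * G z := by
  rw [← indicator_image_sum_roots_indicator hq s G,
    lintegral_indicator (measurableSet_image_eval q hs hinj),
    lintegral_image_eq_lintegral_abs_det_fderiv_mul volume hs
      (fun z _ ↦ hasFDerivWithinAt_eval q s z) hinj]
  refine setLIntegral_congr_fun hs fun z hz ↦ ?_
  rw [det_toSpanSingleton_restrictScalars, abs_of_nonneg (by positivity),
    sum_roots_indicator_eval hq hinj G hz]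

lemma measurable_sum_roots_indicator (q : ℂ[X]) (hq : derivative q ≠ 0) {s : Set ℂ}
    (hs : MeasurableSet s) (hinj : Set.InjOn (fun z ↦ q.eval z) s) {G : ℂ → ENNReal}
    (hG : Measurable G) :
    Measurable fun w ↦ ∑ ζ ∈ (q - C w).roots.toFinset, s.indicator G ζ := by
  have := hs.standardBorel
  rw [← indicator_image_sum_roots_indicator hq s G]
  have hr : (fun z ↦ q.eval z) '' s = Set.range fun z : s ↦ q.eval (z : ℂ) := by
    rw [Set.image_eq_range]
  rw [hr]
  refine measurable_indicator_range (by fun_prop) (hr ▸ measurableSet_image_eval q hs hinj) ?_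
  have : (fun w ↦ ∑ ζ ∈ (q - C w).roots.toFinset, s.indicator G ζ) ∘
      (fun z : s ↦ q.eval (z : ℂ)) = fun z : s ↦ G z := by
    funext z
    exact sum_roots_indicator_eval hq hinj G z.2
  rw [this]
  fun_prop

/-- The inverse function theorem gives injectivity near each noncritical point; the Lindelöf
property leaves countably many neighbourhoods, which are then made disjoint. -/
lemma exists_measurable_partition_injOn (q : ℂ[X]) :
    ∃ A : ℕ → Set ℂ, (∀ k, MeasurableSet (A k)) ∧ Pairwise (Function.onFun Disjoint A) ∧
      (∀ k, Set.InjOn (fun z ↦ q.eval z) (A k)) ∧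
      ⋃ k, A k = {z | (derivative q).eval z ≠ 0} := by
  set U : Set ℂ := {z | (derivative q).eval z ≠ 0} with hU
  have hUo : IsOpen U := isOpen_ne_fun (by fun_prop) (by fun_prop)
  have hloc : ∀ z, ∃ N : Set ℂ, IsOpen N ∧ N ⊆ U ∧ Set.InjOn (fun z ↦ q.eval z) N ∧
      (z ∈ U → z ∈ N) := by
    intro z
    by_cases hz : z ∈ U
    · have hd := (q.hasStrictDerivAt z).hasStrictFDerivAt_equiv hz
      exact ⟨U ∩ (hd.toOpenPartialHomeomorph _).source,
        hUo.inter (hd.toOpenPartialHomeomorph _).open_source, Set.inter_subset_left,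
        (hd.toOpenPartialHomeomorph _).injOn.mono Set.inter_subset_right,
        fun _ ↦ ⟨hz, hd.mem_toOpenPartialHomeomorph_source⟩⟩
    -- Critical points receive the empty set, so that the enumeration below may hit points outside
    -- the cover harmlessly.
    · exact ⟨∅, isOpen_empty, Set.empty_subset _, Set.injOn_empty _, fun h ↦ absurd h hz⟩
  choose N hNo hNU hNinj hN using hloc
  obtain ⟨t, -, htc, ht⟩ := TopologicalSpace.countable_cover_nhdsWithin (s := U) (f := N)
    fun z hz ↦ mem_nhdsWithin_of_mem_nhds ((hNo z).mem_nhds (hN z hz))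
  obtain ⟨e, he⟩ := Set.countable_iff_exists_subset_range.1 htc
  refine ⟨disjointed fun k ↦ N (e k), fun k ↦ .disjointed (fun k ↦ (hNo _).measurableSet) k,
    disjoint_disjointed _, fun k ↦ (hNinj (e k)).mono (disjointed_subset _ _), ?_⟩
  rw [iUnion_disjointed]
  refine subset_antisymm (Set.iUnion_subset fun k ↦ hNU _) (ht.trans ?_)
  refine Set.iUnion₂_subset fun x hx ↦ ?_
  obtain ⟨k, rfl⟩ := he hx
  exact Set.subset_iUnion (fun k ↦ N (e k)) k

/-- The area formula for a nonconstant complex polynomial. -/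
lemma lintegral_sum_roots (q : ℂ[X]) (hq : derivative q ≠ 0) {G : ℂ → ENNReal}
    (hG : Measurable G) :
    ∫⁻ w, ∑ ζ ∈ (q - C w).roots.toFinset, G ζ =
      ∫⁻ z, ENNReal.ofReal (‖(derivative q).eval z‖ ^ 2) * G z := by
  obtain ⟨A, hA, hdisj, hinj, hU⟩ := exists_measurable_partition_injOn q
  have hcrit : {z | (derivative q).eval z = 0}.Finite := by
    refine (derivative q).roots.toFinset.finite_toSet.subset fun z hz ↦ ?_
    simpa [hq] using hz
  -- There are finitely many critical values, so almost every `w` has only noncritical preimages.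
  have hae : ∀ᵐ w : ℂ, ∀ ζ, (derivative q).eval ζ = 0 → q.eval ζ ≠ w := by
    have := (hcrit.image fun z ↦ q.eval z).measure_zero (volume : Measure ℂ)
    filter_upwards [measure_eq_zero_iff_ae_notMem.1 this] with w hw ζ hζ h
    exact hw ⟨ζ, hζ, h⟩
  have hUae : (⋃ k, A k : Set ℂ) =ᵐ[volume] Set.univ := by
    rw [hU]
    refine Filter.eventuallyEq_univ.2 ?_
    filter_upwards [measure_eq_zero_iff_ae_notMem.1 (hcrit.measure_zero volume)] with z hz
    exact hz
  calc _ = ∫⁻ w, ∑' k, ∑ ζ ∈ (q - C w).roots.toFinset, (A k).indicator G ζ := by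
        refine lintegral_congr_ae ?_
        filter_upwards [hae] with w hw
        rw [Summable.tsum_finsetSum fun _ _ ↦ ENNReal.summable]
        refine Finset.sum_congr rfl fun ζ hζ ↦ ?_
        have hζ' : q.eval ζ = w := by
          have := (mem_roots'.1 (Multiset.mem_toFinset.1 hζ)).2
          simpa [sub_eq_zero] using this
        have hmem : ζ ∈ ⋃ k, A k := by
          rw [hU]
          exact fun h ↦ hw ζ h hζ'
        obtain ⟨k, hk⟩ := Set.mem_iUnion.1 hmem
        rw [tsum_eq_single k, Set.indicator_of_mem hk]
        exact fun m hm ↦ Set.indicator_of_notMem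
          (fun h ↦ Set.disjoint_left.1 (hdisj hm) h hk) _
    _ = ∑' k, ∫⁻ z in A k, ENNReal.ofReal (‖(derivative q).eval z‖ ^ 2) * G z := by
        rw [lintegral_tsum fun k ↦
          (measurable_sum_roots_indicator q hq (hA k) (hinj k) hG).aemeasurable]
        exact tsum_congr fun k ↦ lintegral_sum_roots_indicator q hq (hA k) (hinj k) G
    _ = _ := by
        rw [← lintegral_iUnion hA hdisj, Measure.restrict_congr_set hUae, Measure.restrict_univ]

end EllipticEnergy

/-! ### Elliptic polynomials, simple zeros and measurability -/

namespace EllipticEnergy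

open Polynomial

variable {n : ℕ}

lemma sqrt_choose_ne_zero (j : Fin (n + 1)) : (Real.sqrt (n.choose j) : ℂ) ≠ 0 := by
  have : 0 < n.choose j := Nat.choose_pos (Nat.lt_succ_iff.1 j.2)
  exact_mod_cast (Real.sqrt_pos.2 (by exact_mod_cast this)).ne'

lemma eval_ellipticPoly (a : Fin (n + 1) → ℂ) (z : ℂ) :
    (ellipticPoly n a).eval z = ∑ j, a j * (Real.sqrt (n.choose j) * z ^ (j : ℕ)) := by
  simp [ellipticPoly, eval_finsetSum, mul_assoc]

lemma eval_derivative_ellipticPoly (a : Fin (n + 1) → ℂ) (z : ℂ) :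
    (derivative (ellipticPoly n a)).eval z =
      ∑ j, a j * (Real.sqrt (n.choose j) * ((j : ℕ) * z ^ ((j : ℕ) - 1))) := by
  simp [ellipticPoly, eval_finsetSum, mul_assoc, derivative_X_pow]

lemma coeff_ellipticPoly (a : Fin (n + 1) → ℂ) (j : Fin (n + 1)) :
    (ellipticPoly n a).coeff j = a j * Real.sqrt (n.choose j) := by
  rw [ellipticPoly, finsetSum_coeff, Finset.sum_eq_single j]
  · rw [coeff_C_mul, coeff_X_pow_self, mul_one]
  · intro b _ hb
    rw [coeff_C_mul, coeff_X_pow, if_neg (fun h ↦ hb (Fin.ext h.symm)), mul_zero]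
  · simp

lemma natDegree_ellipticPoly_le (a : Fin (n + 1) → ℂ) : (ellipticPoly n a).natDegree ≤ n := by
  refine natDegree_sum_le_of_forall_le _ _ fun j _ ↦ ?_
  exact (natDegree_C_mul_X_pow_le _ _).trans (Nat.lt_succ_iff.1 j.2)

lemma coeff_ellipticPoly_last (a : Fin (n + 1) → ℂ) :
    (ellipticPoly n a).coeff n = a (Fin.last n) := by
  have h := coeff_ellipticPoly a (Fin.last n)
  simpa using h

lemma natDegree_ellipticPoly {a : Fin (n + 1) → ℂ} (ha : a (Fin.last n) ≠ 0) :
    (ellipticPoly n a).natDegree = n :=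
  natDegree_eq_of_le_of_coeff_ne_zero (natDegree_ellipticPoly_le a)
    (by rwa [coeff_ellipticPoly_last])

lemma leadingCoeff_ellipticPoly {a : Fin (n + 1) → ℂ} (ha : a (Fin.last n) ≠ 0) :
    (ellipticPoly n a).leadingCoeff = a (Fin.last n) := by
  rw [leadingCoeff, natDegree_ellipticPoly ha, coeff_ellipticPoly_last]

lemma ellipticPoly_ne_zero {a : Fin (n + 1) → ℂ} (ha : a (Fin.last n) ≠ 0) :
    ellipticPoly n a ≠ 0 := by
  rw [← leadingCoeff_ne_zero, leadingCoeff_ellipticPoly ha]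
  exact ha

lemma ellipticPoly_coeff_div {f : ℂ[X]} (hf : f.natDegree ≤ n) :
    ellipticPoly n (fun j ↦ f.coeff j / Real.sqrt (n.choose j)) = f := by
  ext k
  by_cases hk : k < n + 1
  · have h := coeff_ellipticPoly (fun j : Fin (n + 1) ↦ f.coeff j / Real.sqrt (n.choose j)) ⟨k, hk⟩
    rw [div_mul_cancel₀ _ (sqrt_choose_ne_zero _)] at h
    exact h
  · rw [coeff_eq_zero_of_natDegree_lt ((natDegree_ellipticPoly_le _).trans_lt (by omega)),
      coeff_eq_zero_of_natDegree_lt (hf.trans_lt (by omega))]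

/-- The coefficient vectors of the polynomials of degree `n` with `n` distinct zeros. -/
def goodSet (n : ℕ) : Set (Fin (n + 1) → ℂ) :=
  {a | a (Fin.last n) ≠ 0 ∧ (zeroSet (ellipticPoly n a)).card = n}

lemma card_roots_ellipticPoly {a : Fin (n + 1) → ℂ} (ha : a (Fin.last n) ≠ 0) :
    Multiset.card (ellipticPoly n a).roots = n := by
  rw [IsAlgClosed.card_roots_eq_natDegree, natDegree_ellipticPoly ha]

/-- Over `ℂ` there are `n` roots with multiplicity, so having `n` distinct ones means that none is
shared with the derivative. -/
lemma card_zeroSet_eq_iff {a : Fin (n + 1) → ℂ} (ha : a (Fin.last n) ≠ 0) :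
    (zeroSet (ellipticPoly n a)).card = n ↔
      ∀ z, (ellipticPoly n a).eval z = 0 → (derivative (ellipticPoly n a)).eval z ≠ 0 := by
  have h0 := ellipticPoly_ne_zero ha
  have h1 : (zeroSet (ellipticPoly n a)).card = n ↔ (ellipticPoly n a).roots.Nodup := by
    rw [← Multiset.toFinset_card_eq_card_iff_nodup, card_roots_ellipticPoly ha, zeroSet]
  rw [h1, Multiset.nodup_iff_count_le_one]
  refine forall_congr' fun z ↦ ?_
  rw [count_roots, ← not_lt, one_lt_rootMultiplicity_iff_isRoot h0]
  simp [IsRoot]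

lemma roots_nodup {a : Fin (n + 1) → ℂ} (ha : a ∈ goodSet n) :
    (ellipticPoly n a).roots.Nodup := by
  rw [← Multiset.toFinset_card_eq_card_iff_nodup, card_roots_ellipticPoly ha.1]
  exact ha.2

lemma ellipticPoly_eq_prod {a : Fin (n + 1) → ℂ} (ha : a ∈ goodSet n) :
    ellipticPoly n a =
      C (a (Fin.last n)) * ∏ ζ ∈ zeroSet (ellipticPoly n a), (X - C ζ) := by
  conv_lhs => rw [(IsAlgClosed.splits (ellipticPoly n a)).eq_prod_roots]
  rw [leadingCoeff_ellipticPoly ha.1, zeroSet, Finset.prod, Multiset.toFinset_val,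
    (roots_nodup ha).dedup]

lemma eval_derivative_ellipticPoly_root {a : Fin (n + 1) → ℂ} (ha : a ∈ goodSet n) {ζ : ℂ}
    (hζ : ζ ∈ zeroSet (ellipticPoly n a)) :
    (derivative (ellipticPoly n a)).eval ζ =
      a (Fin.last n) * ∏ ξ ∈ (zeroSet (ellipticPoly n a)).erase ζ, (ζ - ξ) := by
  set Z := zeroSet (ellipticPoly n a)
  rw [ellipticPoly_eq_prod ha, derivative_C_mul, eval_mul, eval_C,
    ← Finset.mul_prod_erase _ _ hζ, derivative_mul]
  simp [eval_prod, Z]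

lemma measurable_coeff_prod {T ι : Type*} [MeasurableSpace T] (s : Finset ι)
    (p : ι → T → ℂ[X]) (hp : ∀ i k, Measurable fun t ↦ (p i t).coeff k) (k : ℕ) :
    Measurable fun t ↦ (∏ i ∈ s, p i t).coeff k := by
  classical
  induction s using Finset.induction_on generalizing k with
  | empty => simp
  | insert i s hi ih =>
    simp only [Finset.prod_insert hi, coeff_mul]
    exact Finset.measurable_fun_sum _ fun x _ ↦ (hp i _).mul (ih _)

/-- The parametrization of `goodSet n` by leading coefficient and zeros. -/
noncomputable def coeffsOfRoots (n : ℕ) (x : {x : ℂ × (Fin n → ℂ) // x.1 ≠ 0 ∧ Function.Injective x.2}) :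
    Fin (n + 1) → ℂ :=
  fun j ↦ (C x.1.1 * ∏ i, (X - C (x.1.2 i))).coeff j / Real.sqrt (n.choose j)

lemma ellipticPoly_coeffsOfRoots
    (x : {x : ℂ × (Fin n → ℂ) // x.1 ≠ 0 ∧ Function.Injective x.2}) :
    ellipticPoly n (coeffsOfRoots n x) = C x.1.1 * ∏ i, (X - C (x.1.2 i)) := by
  refine ellipticPoly_coeff_div ?_
  refine (natDegree_C_mul_le _ _).trans ?_
  simp

lemma zeroSet_coeffsOfRoots
    (x : {x : ℂ × (Fin n → ℂ) // x.1 ≠ 0 ∧ Function.Injective x.2}) :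
    zeroSet (ellipticPoly n (coeffsOfRoots n x)) = Finset.univ.image x.1.2 := by
  rw [ellipticPoly_coeffsOfRoots, zeroSet, roots_C_mul _ x.2.1]
  ext z
  rw [Multiset.mem_toFinset, mem_roots (Finset.prod_ne_zero_iff.2 fun i _ ↦ X_sub_C_ne_zero _),
    IsRoot, eval_prod, Finset.prod_eq_zero_iff]
  simp only [Finset.mem_univ, true_and, eval_sub, eval_X, eval_C, sub_eq_zero, Finset.mem_image,
    eq_comm (a := z)]

lemma range_coeffsOfRoots : Set.range (coeffsOfRoots n) = goodSet n := by
  refine subset_antisymm ?_ fun a ha ↦ ?_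
  · rintro _ ⟨x, rfl⟩
    refine ⟨?_, ?_⟩
    · rw [← coeff_ellipticPoly_last (coeffsOfRoots n x), ellipticPoly_coeffsOfRoots, coeff_C_mul]
      have hm : (∏ i, (X - C (x.1.2 i))).Monic := monic_prod_of_monic _ _ fun i _ ↦
        monic_X_sub_C _
      have hd : (∏ i, (X - C (x.1.2 i))).natDegree = n := by simp
      have := hm.coeff_natDegree
      rw [hd] at this
      rw [this, mul_one]
      exact x.2.1
    · rw [zeroSet_coeffsOfRoots, Finset.card_image_of_injective _ x.2.2, Finset.card_univ,
        Fintype.card_fin]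
  · set e := (zeroSet (ellipticPoly n a)).equivFinOfCardEq ha.2
    refine ⟨⟨(a (Fin.last n), fun i ↦ e.symm i), ha.1,
      Subtype.val_injective.comp e.symm.injective⟩, ?_⟩
    have h : C (a (Fin.last n)) * ∏ i : Fin n, (X - C ((e.symm i : ℂ))) = ellipticPoly n a := by
      conv_rhs => rw [ellipticPoly_eq_prod ha]
      rw [Equiv.prod_comp e.symm (fun z ↦ X - C (z : ℂ)), Finset.prod_coe_sort _ (fun z ↦ X - C z)]
    funext j
    simp only [coeffsOfRoots]
    rw [h, coeff_ellipticPoly, mul_div_cancel_right₀ _ (sqrt_choose_ne_zero j)]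

lemma measurable_coeffsOfRoots : Measurable (coeffsOfRoots n) := by
  refine measurable_pi_lambda _ fun j ↦ ?_
  simp only [coeffsOfRoots, coeff_C_mul]
  refine ((by fun_prop : Measurable _).mul (measurable_coeff_prod _ _ (fun i k ↦ ?_) _)).div_const _
  simp only [coeff_sub, coeff_X, coeff_C]
  split_ifs <;> fun_prop

lemma measurableSet_of_isSigmaCompact {T : Type*} [TopologicalSpace T] [T2Space T]
    [MeasurableSpace T] [BorelSpace T] {s : Set T} (hs : IsSigmaCompact s) : MeasurableSet s := by
  obtain ⟨K, hK, rfl⟩ := hs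
  exact .iUnion fun k ↦ (hK k).measurableSet

/-- Pairs of a polynomial and a multiple zero form a closed, hence σ-compact, set; its projection to
coefficient space is again σ-compact. -/
lemma measurableSet_goodSet : MeasurableSet (goodSet n) := by
  have hS : IsClosed {x : (Fin (n + 1) → ℂ) × ℂ | (ellipticPoly n x.1).eval x.2 = 0 ∧
      (derivative (ellipticPoly n x.1)).eval x.2 = 0} := by
    simp only [eval_ellipticPoly, eval_derivative_ellipticPoly]
    exact (isClosed_eq (by fun_prop) continuous_const).inter
      (isClosed_eq (by fun_prop) continuous_const)
  have hm := measurableSet_of_isSigmaCompact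
    ((isSigmaCompact_univ.of_isClosed_subset hS (Set.subset_univ _)).image continuous_fst)
  have h : goodSet n = {a | a (Fin.last n) ≠ 0} ∩ (Prod.fst '' {x : (Fin (n + 1) → ℂ) × ℂ |
      (ellipticPoly n x.1).eval x.2 = 0 ∧ (derivative (ellipticPoly n x.1)).eval x.2 = 0})ᶜ := by
    ext a
    refine and_congr_right fun ha ↦ ?_
    rw [card_zeroSet_eq_iff ha]
    simp
  rw [h]
  exact (measurableSet_eq_fun (by fun_prop) (by fun_prop)).compl.inter hm.compl

/-- The sum of `H (ζ, f'(ζ))` over the zeros `ζ` of the elliptic polynomial `f` with coefficient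
vector `a`. -/
noncomputable def zeroSum (H : ℂ × ℂ → ENNReal) (a : Fin (n + 1) → ℂ) : ENNReal :=
  ∑ ζ ∈ zeroSet (ellipticPoly n a), H (ζ, (derivative (ellipticPoly n a)).eval ζ)

/-- Pulled back along `coeffsOfRoots`, the sum runs over a fixed index set with measurable terms,
and `measurable_indicator_range` brings this back to coefficient space. -/
lemma measurable_indicator_zeroSum {H : ℂ × ℂ → ENNReal} (hH : Measurable H) :
    Measurable ((goodSet n).indicator (zeroSum H)) := by
  have hX : MeasurableSet {x : ℂ × (Fin n → ℂ) | x.1 ≠ 0 ∧ Function.Injective x.2} := by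
    have h : {x : ℂ × (Fin n → ℂ) | x.1 ≠ 0 ∧ Function.Injective x.2} =
        {x | x.1 ≠ 0} ∩ ⋂ i, ⋂ j, ⋂ (_ : i ≠ j), {x | x.2 i ≠ x.2 j} := by
      ext x
      simp only [Function.Injective, Set.mem_inter_iff, Set.mem_iInter, Set.mem_ofPred_eq, ne_eq,
        not_imp_not]
    rw [h]
    refine (measurableSet_eq_fun (by fun_prop) (by fun_prop)).compl.inter
      (.iInter fun i ↦ .iInter fun j ↦ .iInter fun _ ↦
        (measurableSet_eq_fun (by fun_prop) (by fun_prop)).compl)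
  have : StandardBorelSpace {x : ℂ × (Fin n → ℂ) // x.1 ≠ 0 ∧ Function.Injective x.2} :=
    hX.standardBorel
  rw [← range_coeffsOfRoots]
  refine measurable_indicator_range measurable_coeffsOfRoots
    (range_coeffsOfRoots (n := n) ▸ measurableSet_goodSet) ?_
  have h : zeroSum H ∘ coeffsOfRoots n = fun x ↦ ∑ i, H (x.1.2 i,
      ∑ j, coeffsOfRoots n x j *
        (Real.sqrt (n.choose j) * ((j : ℕ) * x.1.2 i ^ ((j : ℕ) - 1)))) := by
    funext x
    simp only [Function.comp, zeroSum]
    rw [zeroSet_coeffsOfRoots, Finset.sum_image fun i _ j _ h ↦ x.2.2 h]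
    simp only [eval_derivative_ellipticPoly]
  rw [h]
  have hc : ∀ j, Measurable fun x ↦ coeffsOfRoots n x j := fun j ↦
    (measurable_pi_apply j).comp measurable_coeffsOfRoots
  fun_prop

end EllipticEnergy

namespace EllipticEnergy

open Polynomial

/-! ### Covariances of the value and the derivative at a point -/

section Gram

lemma sum_choose_mul_pow (m : ℕ) (r : ℝ) :
    ∑ j : Fin (m + 1), ((m.choose j : ℕ) : ℝ) * r ^ (j : ℕ) = (1 + r) ^ m := by
  rw [Fin.sum_univ_eq_sum_range (fun j ↦ ((m.choose j : ℕ) : ℝ) * r ^ j), add_comm (1 : ℝ) r, add_pow]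
  exact Finset.sum_congr rfl fun j _ ↦ by ring

lemma sum_choose_succ_mul_pow (m : ℕ) (r : ℝ) :
    ∑ j : Fin (m + 1), (((m + 1).choose (j + 1) : ℕ) : ℝ) * r ^ ((j : ℕ) + 1) =
      (1 + r) ^ (m + 1) - 1 := by
  have h := sum_choose_mul_pow (m + 1) r
  rw [Fin.sum_univ_succ] at h
  simp only [Fin.val_zero, Nat.choose_zero_right, Nat.cast_one, pow_zero, mul_one,
    Fin.val_succ] at h
  linarith

lemma succ_mul_choose_cast (m j : ℕ) :
    (((m + 1).choose (j + 1) : ℕ) : ℝ) * (j + 1) = (m + 1) * (m.choose j : ℕ) := by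
  exact_mod_cast (Nat.add_one_mul_choose_eq m j).symm

lemma sum_choose_succ_mul_succ (m : ℕ) (r : ℝ) :
    ∑ j : Fin (m + 1), (((m + 1).choose (j + 1) : ℕ) : ℝ) * ((j : ℕ) + 1) * r ^ (j : ℕ) =
      (m + 1) * (1 + r) ^ m := by
  rw [← sum_choose_mul_pow, Finset.mul_sum]
  refine Finset.sum_congr rfl fun j _ ↦ ?_
  rw [succ_mul_choose_cast, mul_assoc]

/-- The factor `1 + r` avoids the exponent `m - 1`, which would be truncated at `m = 0`. -/
lemma sum_choose_mul_self (m : ℕ) (r : ℝ) :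
    (1 + r) * ∑ j : Fin (m + 1), ((m.choose j : ℕ) : ℝ) * (j : ℕ) * r ^ (j : ℕ) =
      m * r * (1 + r) ^ m := by
  cases m with
  | zero => simp
  | succ k =>
    rw [Fin.sum_univ_succ]
    have h := sum_choose_succ_mul_succ k r
    have h2 : ∑ j : Fin (k + 1), (((k + 1).choose (j.succ : ℕ) : ℕ) : ℝ) * ((j.succ : ℕ) : ℝ) *
        r ^ (j.succ : ℕ) = r * ((k + 1) * (1 + r) ^ k) := by
      rw [← h, Finset.mul_sum]
      refine Finset.sum_congr rfl fun j _ ↦ ?_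
      push_cast [Fin.val_succ]
      ring
    rw [h2]
    push_cast
    simp
    ring

lemma sum_choose_succ_mul_succ_sq (m : ℕ) (r : ℝ) :
    (1 + r) * ∑ j : Fin (m + 1), (((m + 1).choose (j + 1) : ℕ) : ℝ) * ((j : ℕ) + 1) ^ 2 *
      r ^ (j : ℕ) = (m + 1) * (1 + (m + 1) * r) * (1 + r) ^ m := by
  have h : ∑ j : Fin (m + 1), (((m + 1).choose (j + 1) : ℕ) : ℝ) * ((j : ℕ) + 1) ^ 2 *
      r ^ (j : ℕ) = (m + 1) * (∑ j : Fin (m + 1), ((m.choose j : ℕ) : ℝ) * (j : ℕ) * r ^ (j : ℕ) +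
        ∑ j : Fin (m + 1), ((m.choose j : ℕ) : ℝ) * r ^ (j : ℕ)) := by
    rw [← Finset.sum_add_distrib, Finset.mul_sum]
    refine Finset.sum_congr rfl fun j _ ↦ ?_
    linear_combination ((j : ℕ) + 1 : ℝ) * r ^ (j : ℕ) * succ_mul_choose_cast m j
  rw [h, sum_choose_mul_pow]
  linear_combination (m + 1 : ℝ) * sum_choose_mul_self m r

/-- The values at `z` of the nonconstant basis functions of degree `m + 1`. -/
noncomputable def basisVal (m : ℕ) (z : ℂ) (j : Fin (m + 1)) : ℂ :=
  Real.sqrt ((m + 1).choose (j + 1)) * z ^ ((j : ℕ) + 1)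

/-- The derivatives at `z` of the nonconstant basis functions of degree `m + 1`. -/
noncomputable def basisDeriv (m : ℕ) (z : ℂ) (j : Fin (m + 1)) : ℂ :=
  Real.sqrt ((m + 1).choose (j + 1)) * (((j : ℕ) + 1) * z ^ (j : ℕ))

lemma sum_norm_sq_basisVal (m : ℕ) (z : ℂ) :
    ∑ j, ‖basisVal m z j‖ ^ 2 = (1 + ‖z‖ ^ 2) ^ (m + 1) - 1 := by
  rw [← sum_choose_succ_mul_pow]
  refine Finset.sum_congr rfl fun j _ ↦ ?_
  rw [basisVal, norm_mul, mul_pow, Complex.norm_of_nonneg (Real.sqrt_nonneg _),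
    Real.sq_sqrt (Nat.cast_nonneg _), norm_pow]
  ring

lemma sum_norm_sq_basisDeriv (m : ℕ) (z : ℂ) :
    (1 + ‖z‖ ^ 2) * ∑ j, ‖basisDeriv m z j‖ ^ 2 =
      (m + 1) * (1 + (m + 1) * ‖z‖ ^ 2) * (1 + ‖z‖ ^ 2) ^ m := by
  rw [← sum_choose_succ_mul_succ_sq]
  congr 1
  refine Finset.sum_congr rfl fun j _ ↦ ?_
  have h : ‖((j : ℕ) : ℂ) + 1‖ = (j : ℕ) + 1 := by
    exact_mod_cast Complex.norm_natCast ((j : ℕ) + 1)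
  rw [basisDeriv, norm_mul, norm_mul, mul_pow, mul_pow, h,
    Complex.norm_of_nonneg (Real.sqrt_nonneg _), Real.sq_sqrt (Nat.cast_nonneg _), norm_pow]
  ring

lemma sum_basisVal_mul_conj (m : ℕ) (z : ℂ) :
    ∑ j, basisVal m z j * starRingEnd ℂ (basisDeriv m z j) =
      z * (((m + 1) * (1 + ‖z‖ ^ 2) ^ m : ℝ) : ℂ) := by
  rw [← sum_choose_succ_mul_succ]
  push_cast
  rw [Finset.mul_sum]
  refine Finset.sum_congr rfl fun j _ ↦ ?_
  have h1 : ((Real.sqrt ((m + 1).choose (j + 1)) : ℝ) : ℂ) *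
      (Real.sqrt ((m + 1).choose (j + 1)) : ℝ) = ((m + 1).choose (j + 1) : ℕ) := by
    rw [← Complex.ofReal_mul, Real.mul_self_sqrt (Nat.cast_nonneg _), Complex.ofReal_natCast]
  have h2 : (‖z‖ : ℂ) ^ 2 = z * starRingEnd ℂ z := (Complex.mul_conj' z).symm
  simp only [basisVal, basisDeriv, map_mul, map_add, map_pow, map_one, map_natCast,
    Complex.conj_ofReal]
  rw [h2, ← h1]
  ring

/-- The standard deviation of the derivative at a zero `z`. -/
noncomputable def derivDev (n : ℕ) (z : ℂ) : ℝ :=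
  Real.sqrt (n * (1 + ‖z‖ ^ 2) ^ n) / (1 + ‖z‖ ^ 2)

lemma derivDev_sq (n : ℕ) (z : ℂ) :
    derivDev n z ^ 2 = n * (1 + ‖z‖ ^ 2) ^ n / (1 + ‖z‖ ^ 2) ^ 2 := by
  rw [derivDev, div_pow, Real.sq_sqrt (by positivity)]

/-- This is the variance hypothesis of `lintegral_tilted_pi`. The vectors omit the constant basis
function, so `S = (1+|z|²)^(m+1) - 1`; the `1` added back is the variance of `a_0`. -/
lemma basisDeriv_variance (m : ℕ) (z : ℂ) :
    ∑ j, ‖basisDeriv m z j‖ ^ 2 = derivDev (m + 1) z ^ 2 +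
      ‖∑ j, basisVal m z j * starRingEnd ℂ (basisDeriv m z j)‖ ^ 2 /
        (1 + ((1 + ‖z‖ ^ 2) ^ (m + 1) - 1)) := by
  have hr : 0 < 1 + ‖z‖ ^ 2 := by positivity
  have h := sum_norm_sq_basisDeriv m z
  rw [mul_comm, ← eq_div_iff hr.ne'] at h
  rw [h, sum_basisVal_mul_conj, norm_mul, Complex.norm_of_nonneg (by positivity), derivDev_sq,
    add_sub_cancel]
  push_cast
  field_simp
  ring

end Gram

/-! ### The Kac–Rice formula -/

section KacRice

lemma lintegral_pi_cons {m : ℕ} {F : (Fin (m + 1) → ℂ) → ENNReal} (hF : Measurable F) :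
    ∫⁻ a, F a ∂Measure.pi (fun _ ↦ stdComplexGaussian) =
      ∫⁻ b : Fin m → ℂ, ∫⁻ c, F (Fin.cons c b) ∂stdComplexGaussian
        ∂Measure.pi (fun _ ↦ stdComplexGaussian) := by
  have h := (measurePreserving_piFinSuccAbove
    (fun _ : Fin (m + 1) ↦ stdComplexGaussian) 0).symm
  rw [← h.lintegral_comp hF, lintegral_prod_symm _ (by fun_prop)]
  simp only [MeasurableEquiv.piFinSuccAbove, Fin.insertNthEquiv_zero]
  rfl

lemma ellipticPoly_cons {m : ℕ} (c : ℂ) (b : Fin (m + 1) → ℂ) :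
    ellipticPoly (m + 1) (Fin.cons c b) =
      ellipticPoly (m + 1) (Fin.cons 0 b) - C (-c) := by
  simp [ellipticPoly, Fin.sum_univ_succ, add_comm]

lemma derivative_ellipticPoly_cons {m : ℕ} (c : ℂ) (b : Fin (m + 1) → ℂ) :
    derivative (ellipticPoly (m + 1) (Fin.cons c b)) =
      derivative (ellipticPoly (m + 1) (Fin.cons 0 b)) := by
  rw [ellipticPoly_cons, derivative_sub, derivative_C, sub_zero]

lemma derivative_ellipticPoly_ne_zero {m : ℕ} {a : Fin (m + 2) → ℂ} (ha : a (Fin.last _) ≠ 0) :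
    derivative (ellipticPoly (m + 1) a) ≠ 0 := by
  intro h
  have h1 := derivative_eq_zero.1 h
  rw [natDegree_ellipticPoly ha] at h1
  omega

lemma cons_last {m : ℕ} (c : ℂ) (b : Fin (m + 1) → ℂ) :
    (Fin.cons c b : Fin (m + 2) → ℂ) (Fin.last _) = b (Fin.last m) := by
  rw [← Fin.succ_last, Fin.cons_succ]

lemma eval_ellipticPoly_cons_zero {m : ℕ} (b : Fin (m + 1) → ℂ) (z : ℂ) :
    (ellipticPoly (m + 1) (Fin.cons 0 b)).eval z = ∑ j, b j * basisVal m z j := by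
  rw [eval_ellipticPoly, Fin.sum_univ_succ]
  simp [basisVal]

lemma eval_derivative_ellipticPoly_cons_zero {m : ℕ} (b : Fin (m + 1) → ℂ) (z : ℂ) :
    (derivative (ellipticPoly (m + 1) (Fin.cons 0 b))).eval z =
      ∑ j, b j * basisDeriv m z j := by
  rw [eval_derivative_ellipticPoly, Fin.sum_univ_succ]
  simp [basisDeriv]

/-- A multiple zero forces `-c` to be one of the finitely many critical values of `q`. -/
lemma cons_mem_goodSet_ae {m : ℕ} {b : Fin (m + 1) → ℂ} (hb : b (Fin.last m) ≠ 0) :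
    ∀ᵐ c : ℂ, (Fin.cons c b : Fin (m + 2) → ℂ) ∈ goodSet (m + 1) := by
  set q := ellipticPoly (m + 1) (Fin.cons 0 b) with hq
  have hq' : derivative q ≠ 0 := derivative_ellipticPoly_ne_zero (by rwa [cons_last])
  have hfin : ((fun z ↦ -q.eval z) '' ((derivative q).roots.toFinset : Set ℂ)).Finite :=
    (Finset.finite_toSet _).image _
  filter_upwards [measure_eq_zero_iff_ae_notMem.1 (hfin.measure_zero volume)] with c hc
  have hl : (Fin.cons c b : Fin (m + 2) → ℂ) (Fin.last _) ≠ 0 := by rwa [cons_last]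
  refine ⟨hl, (card_zeroSet_eq_iff hl).2 fun z hz hz' ↦ hc ⟨z, ?_, ?_⟩⟩
  · rw [derivative_ellipticPoly_cons] at hz'
    simpa [hq'] using hz'
  · rw [ellipticPoly_cons, eval_sub, eval_C, sub_neg_eq_add] at hz
    exact (eq_neg_of_add_eq_zero_right hz).symm

lemma ae_pi_ne_zero {m : ℕ} (i : Fin m) :
    ∀ᵐ b ∂Measure.pi (fun _ : Fin m ↦ stdComplexGaussian), b i ≠ 0 := by
  have h0 : ∀ᵐ z ∂stdComplexGaussian, z ≠ 0 :=
    stdComplexGaussian_absolutelyContinuous.ae_le (Measure.ae_ne volume 0)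
  exact (measurePreserving_eval (fun _ : Fin m ↦ stdComplexGaussian) i).quasiMeasurePreserving.ae h0

lemma mem_goodSet_ae (m : ℕ) :
    ∀ᵐ a ∂Measure.pi (fun _ : Fin (m + 2) ↦ stdComplexGaussian), a ∈ goodSet (m + 1) := by
  rw [ae_iff]
  change Measure.pi _ (goodSet (m + 1))ᶜ = 0
  rw [← lintegral_indicator_one measurableSet_goodSet.compl, lintegral_pi_cons
    (measurable_one.indicator measurableSet_goodSet.compl)]
  rw [← lintegral_zero (μ := Measure.pi (fun _ : Fin (m + 1) ↦ stdComplexGaussian))]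
  refine lintegral_congr_ae ?_
  filter_upwards [ae_pi_ne_zero (Fin.last m)] with b hb
  rw [← lintegral_zero (μ := stdComplexGaussian)]
  refine lintegral_congr_ae ?_
  filter_upwards [stdComplexGaussian_absolutelyContinuous.ae_le (cons_mem_goodSet_ae hb)] with c hc
  exact Set.indicator_of_notMem (by simpa using hc) _

lemma lintegral_zeroSum_cons {m : ℕ} {H : ℂ × ℂ → ENNReal} (hH : Measurable H)
    {b : Fin (m + 1) → ℂ} (hb : b (Fin.last m) ≠ 0) :
    ∫⁻ c, (goodSet (m + 1)).indicator (zeroSum H) (Fin.cons c b) ∂stdComplexGaussian =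
      ∫⁻ z : ℂ, ENNReal.ofReal (‖∑ j, b j * basisDeriv m z j‖ ^ 2) *
        (ENNReal.ofReal (Real.pi⁻¹ * Real.exp (-‖∑ j, b j * basisVal m z j‖ ^ 2)) *
          H (z, ∑ j, b j * basisDeriv m z j)) := by
  set q := ellipticPoly (m + 1) (Fin.cons 0 b) with hq
  have hq' : derivative q ≠ 0 := derivative_ellipticPoly_ne_zero (by rwa [cons_last])
  have hm : Measurable fun c : ℂ ↦
      (goodSet (m + 1)).indicator (zeroSum H) (Fin.cons c b : Fin (m + 2) → ℂ) := by
    refine (measurable_indicator_zeroSum hH).comp (measurable_pi_lambda _ fun j ↦ ?_)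
    refine Fin.cases ?_ (fun i ↦ ?_) j
    · simpa using measurable_id'
    · simp
  set G : ℂ → ENNReal := fun z ↦
    ENNReal.ofReal (Real.pi⁻¹ * Real.exp (-‖q.eval z‖ ^ 2)) * H (z, (derivative q).eval z) with hGd
  have hG : Measurable G := by fun_prop
  -- At a zero `ζ` one has `c = -q(ζ)`, so the density of `c` can be written as a function of `ζ`
  -- and moved inside the sum.
  have hsum : ∀ c : ℂ, ENNReal.ofReal (Real.pi⁻¹ * Real.exp (-‖c‖ ^ 2)) *
      zeroSum H (Fin.cons c b : Fin (m + 2) → ℂ) = ∑ ζ ∈ (q - C (-c)).roots.toFinset, G ζ := by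
    intro c
    rw [zeroSum, derivative_ellipticPoly_cons, ellipticPoly_cons, Finset.mul_sum]
    refine Finset.sum_congr rfl fun ζ hζ ↦ ?_
    have h : q.eval ζ = -c := (mem_roots_sub_C_toFinset hq').1 hζ
    simp only [hGd]
    rw [h, norm_neg]
  rw [lintegral_stdComplexGaussian hm]
  calc _ = ∫⁻ c : ℂ, ∑ ζ ∈ (q - C (-c)).roots.toFinset, G ζ := by
        refine lintegral_congr_ae ?_
        filter_upwards [cons_mem_goodSet_ae hb] with c hc
        rw [Set.indicator_of_mem hc, hsum]
    _ = ∫⁻ w : ℂ, ∑ ζ ∈ (q - C w).roots.toFinset, G ζ :=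
        (Measure.measurePreserving_neg volume).lintegral_comp_emb
          (MeasurableEquiv.neg ℂ).measurableEmbedding
          (fun w ↦ ∑ ζ ∈ (q - C w).roots.toFinset, G ζ)
    _ = _ := by
        rw [lintegral_sum_roots q hq' hG]
        simp only [hGd, hq, eval_ellipticPoly_cons_zero, eval_derivative_ellipticPoly_cons_zero]

/-- The intensity measure of the zeros, together with an independent size-biased Gaussian. -/
noncomputable def zeroIntensity (n : ℕ) : Measure (ℂ × ℂ) :=
  (volume.withDensity fun z : ℂ ↦
      ENNReal.ofReal (n * (Real.pi⁻¹ * ((1 + ‖z‖ ^ 2) ^ 2)⁻¹))).prod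
    (stdComplexGaussian.withDensity fun g ↦ ENNReal.ofReal (‖g‖ ^ 2))

lemma lintegral_pi_derivative {m : ℕ} {H : ℂ × ℂ → ENNReal} (hH : Measurable H) {z : ℂ}
    (hz : z ≠ 0) :
    ∫⁻ b : Fin (m + 1) → ℂ, ENNReal.ofReal (‖∑ j, b j * basisDeriv m z j‖ ^ 2) *
        (ENNReal.ofReal (Real.pi⁻¹ * Real.exp (-‖∑ j, b j * basisVal m z j‖ ^ 2)) *
          H (z, ∑ j, b j * basisDeriv m z j)) ∂Measure.pi (fun _ ↦ stdComplexGaussian) =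
      ENNReal.ofReal ((m + 1 : ℕ) * (Real.pi⁻¹ * ((1 + ‖z‖ ^ 2) ^ 2)⁻¹)) *
        ∫⁻ g, ENNReal.ofReal (‖g‖ ^ 2) * H (z, derivDev (m + 1) z * g) ∂stdComplexGaussian := by
  have hr : 1 < 1 + ‖z‖ ^ 2 := by
    have := norm_pos_iff.2 hz
    nlinarith
  -- At `z = 0` every nonconstant basis function vanishes and the tilt degenerates, so this null
  -- point is excluded.
  have hS : 0 < (1 + ‖z‖ ^ 2) ^ (m + 1) - 1 := sub_pos.2 (one_lt_pow₀ hr (by omega))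
  have h := lintegral_tilted_pi (basisVal m z) (basisDeriv m z) hS (sum_norm_sq_basisVal m z)
    (basisDeriv_variance m z) (G := fun w ↦ ENNReal.ofReal Real.pi⁻¹ *
      (ENNReal.ofReal (‖w‖ ^ 2) * H (z, w))) (by fun_prop)
  calc _ = _ := by
        refine lintegral_congr fun b ↦ ?_
        rw [ENNReal.ofReal_mul (by positivity)]
        ring
    _ = _ := h
    _ = _ := by
        rw [← lintegral_const_mul _ (by fun_prop), ← lintegral_const_mul _ (by fun_prop)]
        refine lintegral_congr fun g ↦ ?_
        rw [norm_mul, mul_pow, Complex.norm_real, Real.norm_eq_abs, sq_abs, derivDev_sq,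
          ENNReal.ofReal_mul (by positivity), ← mul_assoc, ← mul_assoc, ← mul_assoc, ← mul_assoc,
          ← ENNReal.ofReal_mul (by positivity), ← ENNReal.ofReal_mul (by positivity),
          add_sub_cancel]
        congr 3
        field_simp

/-- The Kac–Rice formula for elliptic polynomials. -/
theorem lintegral_zeroSum {m : ℕ} {H : ℂ × ℂ → ENNReal} (hH : Measurable H) :
    ∫⁻ a : Fin (m + 2) → ℂ, zeroSum H a ∂Measure.pi (fun _ ↦ stdComplexGaussian) =
      ∫⁻ x, H (x.1, derivDev (m + 1) x.1 * x.2) ∂zeroIntensity (m + 1) := by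
  have hdev : Measurable (derivDev (m + 1)) := by unfold derivDev; fun_prop
  have hG : Measurable fun x : ℂ × ℂ ↦ H (x.1, derivDev (m + 1) x.1 * x.2) := by fun_prop
  have hv : ∀ j, Measurable fun z ↦ basisVal m z j := fun j ↦ by unfold basisVal; fun_prop
  have hd : ∀ j, Measurable fun z ↦ basisDeriv m z j := fun j ↦ by unfold basisDeriv; fun_prop
  calc _ = ∫⁻ a, (goodSet (m + 1)).indicator (zeroSum H) a
        ∂Measure.pi (fun _ ↦ stdComplexGaussian) := by
        refine lintegral_congr_ae ?_
        filter_upwards [mem_goodSet_ae m] with a ha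
        rw [Set.indicator_of_mem ha]
    _ = ∫⁻ b : Fin (m + 1) → ℂ, ∫⁻ z : ℂ, ENNReal.ofReal (‖∑ j, b j * basisDeriv m z j‖ ^ 2) *
        (ENNReal.ofReal (Real.pi⁻¹ * Real.exp (-‖∑ j, b j * basisVal m z j‖ ^ 2)) *
          H (z, ∑ j, b j * basisDeriv m z j)) ∂volume ∂Measure.pi (fun _ ↦ stdComplexGaussian) := by
        rw [lintegral_pi_cons (measurable_indicator_zeroSum hH)]
        refine lintegral_congr_ae ?_
        filter_upwards [ae_pi_ne_zero (Fin.last m)] with b hb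
        exact lintegral_zeroSum_cons hH hb
    _ = ∫⁻ z : ℂ, ENNReal.ofReal ((m + 1 : ℕ) * (Real.pi⁻¹ * ((1 + ‖z‖ ^ 2) ^ 2)⁻¹)) *
        ∫⁻ g, ENNReal.ofReal (‖g‖ ^ 2) * H (z, derivDev (m + 1) z * g) ∂stdComplexGaussian := by
        rw [lintegral_lintegral_swap (Measurable.aemeasurable (by
          unfold Function.uncurry; fun_prop))]
        refine lintegral_congr_ae ?_
        filter_upwards [Measure.ae_ne volume (0 : ℂ)] with z hz
        exact lintegral_pi_derivative hH hz
    _ = _ := by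
        rw [zeroIntensity, lintegral_prod _ hG.aemeasurable,
          lintegral_withDensity_eq_lintegral_mul _ (by fun_prop) hG.lintegral_prod_right']
        refine lintegral_congr fun z ↦ ?_
        rw [Pi.mul_apply, lintegral_withDensity_eq_lintegral_mul _ (by fun_prop) (by fun_prop)]
        rfl

end KacRice

end EllipticEnergy

/-! ### Radial integrals on the sphere and for the Gaussian -/

namespace EllipticEnergy

open Filter Topology Set

lemma integral_norm_complex (f : ℝ → ℝ) :
    ∫ z : ℂ, f ‖z‖ = Real.pi * ∫ y in Ioi (0 : ℝ), 2 * (y * f y) := by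
  rw [integral_fun_norm_addHaar volume f, Complex.finrank_real_complex, Measure.real,
    Complex.volume_ball, integral_const_mul]
  simp
  ring

lemma integrable_norm_complex {f : ℝ → ℝ} :
    Integrable (fun z : ℂ ↦ f ‖z‖) ↔ IntegrableOn (fun y ↦ y * f y) (Ioi 0) := by
  rw [integrable_fun_norm_addHaar volume (f := f), Complex.finrank_real_complex]
  simp

/-- A radial integral computed from a nonnegative derivative. -/
lemma radial_of_hasDerivAt_of_nonneg {f F : ℝ → ℝ} {L : ℝ} (hc : ContinuousWithinAt F (Ici 0) 0)
    (hd : ∀ y ∈ Ioi (0 : ℝ), HasDerivAt F (2 * (y * f y)) y) (hf : ∀ y ∈ Ioi (0 : ℝ), 0 ≤ f y)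
    (hL : Tendsto F atTop (𝓝 L)) :
    Integrable (fun z : ℂ ↦ f ‖z‖) ∧ ∫ z : ℂ, f ‖z‖ = Real.pi * (L - F 0) := by
  have hpos : ∀ y ∈ Ioi (0 : ℝ), 0 ≤ 2 * (y * f y) := fun y hy ↦
    mul_nonneg two_pos.le (mul_nonneg (le_of_lt hy) (hf y hy))
  refine ⟨?_, ?_⟩
  · rw [integrable_norm_complex]
    have h := (integrableOn_Ioi_deriv_of_nonneg hc hd hpos hL).const_mul (1 / 2 : ℝ)
    refine h.congr (.of_forall fun y ↦ ?_)
    simp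
  · rw [integral_norm_complex, integral_Ioi_of_hasDerivAt_of_nonneg hc hd hpos hL]

lemma hasDerivAt_one_add_sq (y : ℝ) : HasDerivAt (fun y : ℝ ↦ 1 + y ^ 2) (2 * y) y := by
  simpa using (hasDerivAt_pow 2 y).const_add 1

lemma tendsto_one_add_sq_atTop : Tendsto (fun y : ℝ ↦ 1 + y ^ 2) atTop atTop :=
  tendsto_atTop_add_const_left _ _ (tendsto_pow_atTop two_ne_zero)

lemma sphere_mass :
    Integrable (fun z : ℂ ↦ Real.pi⁻¹ * ((1 + ‖z‖ ^ 2) ^ 2)⁻¹) ∧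
      ∫ z : ℂ, Real.pi⁻¹ * ((1 + ‖z‖ ^ 2) ^ 2)⁻¹ = 1 := by
  have h := radial_of_hasDerivAt_of_nonneg (f := fun y ↦ ((1 + y ^ 2) ^ 2)⁻¹)
    (F := fun y ↦ -(1 + y ^ 2)⁻¹) (L := 0)
    (by
      refine Continuous.continuousWithinAt ?_
      fun_prop (disch := intro y; positivity))
    (fun y _ ↦ by
      have hy : (1 + y ^ 2) ≠ 0 := by positivity
      refine ((hasDerivAt_one_add_sq y).inv hy).neg.congr_deriv ?_
      field_simp)
    (fun y _ ↦ by positivity)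
    (by simpa using (tendsto_inv_atTop_zero.comp tendsto_one_add_sq_atTop).neg)
  refine ⟨h.1.const_mul _, ?_⟩
  rw [integral_const_mul, h.2]
  simp [Real.pi_ne_zero]

lemma sphere_log_potential :
    Integrable (fun z : ℂ ↦ Real.pi⁻¹ * ((1 + ‖z‖ ^ 2) ^ 2)⁻¹ * Real.log (1 + ‖z‖ ^ 2)) ∧
      ∫ z : ℂ, Real.pi⁻¹ * ((1 + ‖z‖ ^ 2) ^ 2)⁻¹ * Real.log (1 + ‖z‖ ^ 2) = 1 := by
  have hlim : Tendsto (fun x : ℝ ↦ -((Real.log x + 1) * x⁻¹)) atTop (𝓝 0) := by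
    have h1 : Tendsto (fun x : ℝ ↦ Real.log x / x) atTop (𝓝 0) := by
      simpa using Real.tendsto_pow_log_div_mul_add_atTop 1 0 1 one_ne_zero
    have h2 := (h1.add tendsto_inv_atTop_zero).neg
    simp only [add_zero, neg_zero] at h2
    refine h2.congr fun x ↦ ?_
    ring
  have h := radial_of_hasDerivAt_of_nonneg
    (f := fun y ↦ ((1 + y ^ 2) ^ 2)⁻¹ * Real.log (1 + y ^ 2))
    -- With `x = 1 + y²` the integrand is `x⁻² log x dx`, whose primitive is `-(log x + 1)/x`.
    (F := fun y ↦ -((Real.log (1 + y ^ 2) + 1) * (1 + y ^ 2)⁻¹)) (L := 0)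
    (by
      refine Continuous.continuousWithinAt ?_
      fun_prop (disch := intro y; positivity))
    (fun y _ ↦ by
      have hy : (1 + y ^ 2) ≠ 0 := by positivity
      have hd := hasDerivAt_one_add_sq y
      refine (((hd.log hy).add_const 1).mul (hd.inv hy)).neg.congr_deriv ?_
      simp only [Pi.inv_apply]
      field_simp
      ring)
    (fun y _ ↦ mul_nonneg (by positivity) (Real.log_nonneg (by nlinarith)))
    (hlim.comp tendsto_one_add_sq_atTop)
  simp only [mul_assoc]
  refine ⟨h.1.const_mul _, ?_⟩
  rw [integral_const_mul, h.2]
  simp [Real.pi_ne_zero]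

lemma integrable_pow_mul_exp_neg_sq (k : ℕ) :
    Integrable fun y : ℝ ↦ y ^ k * Real.exp (-y ^ 2) := by
  have h := integrable_rpow_mul_exp_neg_mul_sq (b := 1) one_pos (s := k)
    (by have : (0 : ℝ) ≤ k := k.cast_nonneg
        linarith)
  simpa [Real.rpow_natCast] using h

/-- The bound `log t ≤ t - 1`, used at both `y` and `1/y`, controls infinity and the origin at once.
-/
lemma abs_mul_log_le {y : ℝ} (hy : 0 < y) : |y * Real.log y| ≤ y ^ 2 + 1 := by
  have h1 := Real.log_le_sub_one_of_pos hy
  have h2 := Real.log_le_sub_one_of_pos (inv_pos.2 hy)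
  rw [Real.log_inv] at h2
  have h3 := mul_le_mul_of_nonneg_left h1 hy.le
  have h4 := mul_le_mul_of_nonneg_left h2 hy.le
  rw [mul_sub, mul_inv_cancel₀ hy.ne'] at h4
  rw [abs_le]
  constructor <;> nlinarith

lemma integrableOn_pow_mul_log_mul_exp (k : ℕ) :
    IntegrableOn (fun y : ℝ ↦ y ^ (k + 1) * Real.log y * Real.exp (-y ^ 2)) (Ioi 0) := by
  have h := (integrable_pow_mul_exp_neg_sq (k + 2)).add (integrable_pow_mul_exp_neg_sq k)
  refine Integrable.mono' h.integrableOn (Measurable.aestronglyMeasurable (by fun_prop)) ?_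
  filter_upwards [ae_restrict_mem measurableSet_Ioi] with y hy
  have hy0 : 0 < y := hy
  rw [Pi.add_apply, ← add_mul, norm_mul, Real.norm_of_nonneg (Real.exp_pos _).le]
  gcongr
  rw [pow_succ, mul_assoc, norm_mul, norm_pow, Real.norm_of_nonneg hy0.le, Real.norm_eq_abs,
    pow_add, ← mul_add_one]
  gcongr
  exact abs_mul_log_le hy0

lemma integrable_stdComplexGaussian_iff {f : ℝ → ℝ} :
    Integrable (fun z : ℂ ↦ f ‖z‖) stdComplexGaussian ↔
      IntegrableOn (fun y ↦ y * (f y * Real.exp (-y ^ 2))) (Ioi 0) := by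
  rw [stdComplexGaussian, integrable_withDensity_iff_integrable_smul' measurable_density
    (by simp), ← integrable_norm_complex (f := fun y ↦ f y * Real.exp (-y ^ 2)),
    ← integrable_const_mul_iff (c := Real.pi⁻¹) (IsUnit.mk0 _ (by positivity))
      (fun z : ℂ ↦ f ‖z‖ * Real.exp (-‖z‖ ^ 2))]
  refine integrable_congr (.of_forall fun z ↦ ?_)
  simp only [smul_eq_mul]
  rw [ENNReal.toReal_ofReal (by positivity)]
  ring

lemma integral_stdComplexGaussian_norm (f : ℝ → ℝ) :
    ∫ z : ℂ, f ‖z‖ ∂stdComplexGaussian =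
      ∫ y in Ioi (0 : ℝ), 2 * (y * (f y * Real.exp (-y ^ 2))) := by
  rw [integral_stdComplexGaussian]
  have h : ∀ z : ℂ, (Real.pi⁻¹ * Real.exp (-‖z‖ ^ 2)) • f ‖z‖ =
      Real.pi⁻¹ * (f ‖z‖ * Real.exp (-‖z‖ ^ 2)) := fun z ↦ by rw [smul_eq_mul]; ring
  simp_rw [h]
  rw [integral_const_mul, integral_norm_complex (fun y ↦ f y * Real.exp (-y ^ 2)), ← mul_assoc,
    inv_mul_cancel₀ Real.pi_ne_zero, one_mul]

lemma integrable_log_norm : Integrable (fun z : ℂ ↦ Real.log ‖z‖) stdComplexGaussian := by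
  rw [integrable_stdComplexGaussian_iff]
  simpa [mul_assoc] using integrableOn_pow_mul_log_mul_exp 0

lemma integrable_norm_sq : Integrable (fun z : ℂ ↦ ‖z‖ ^ 2) stdComplexGaussian := by
  rw [integrable_stdComplexGaussian_iff (f := fun y ↦ y ^ 2)]
  refine (integrable_pow_mul_exp_neg_sq 3).integrableOn.congr (.of_forall fun y ↦ ?_)
  ring

lemma integrable_norm_sq_mul_log :
    Integrable (fun z : ℂ ↦ ‖z‖ ^ 2 * Real.log ‖z‖) stdComplexGaussian := by
  rw [integrable_stdComplexGaussian_iff (f := fun y ↦ y ^ 2 * Real.log y)]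
  refine (integrableOn_pow_mul_log_mul_exp 2).congr (.of_forall fun y ↦ ?_)
  ring

lemma hasDerivAt_exp_neg_sq (y : ℝ) :
    HasDerivAt (fun y : ℝ ↦ Real.exp (-y ^ 2)) (Real.exp (-y ^ 2) * -(2 * y)) y := by
  simpa using ((hasDerivAt_pow 2 y).neg).exp

lemma tendsto_pow_mul_exp_neg_sq (k : ℕ) :
    Tendsto (fun y : ℝ ↦ (y ^ 2) ^ k * Real.exp (-y ^ 2)) atTop (𝓝 0) :=
  (Real.tendsto_pow_mul_exp_neg_atTop_nhds_zero k).comp (tendsto_pow_atTop two_ne_zero)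

lemma integral_norm_sq : ∫ z : ℂ, ‖z‖ ^ 2 ∂stdComplexGaussian = 1 := by
  have hd : ∀ y ∈ Ioi (0 : ℝ), HasDerivAt (fun y ↦ -((y ^ 2 + 1) * Real.exp (-y ^ 2)))
      (2 * (y * (y ^ 2 * Real.exp (-y ^ 2)))) y := fun y _ ↦ by
    refine (((hasDerivAt_pow 2 y).add_const 1).mul (hasDerivAt_exp_neg_sq y)).neg.congr_deriv ?_
    simp
    ring
  have hi : IntegrableOn (fun y : ℝ ↦ 2 * (y * (y ^ 2 * Real.exp (-y ^ 2)))) (Ioi 0) := by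
    refine ((integrable_pow_mul_exp_neg_sq 3).const_mul 2).integrableOn.congr
      (.of_forall fun y ↦ ?_)
    ring
  have ht : Tendsto (fun y : ℝ ↦ -((y ^ 2 + 1) * Real.exp (-y ^ 2))) atTop (𝓝 0) := by
    have h := ((tendsto_pow_mul_exp_neg_sq 1).add (tendsto_pow_mul_exp_neg_sq 0)).neg
    simp only [add_zero, neg_zero] at h
    refine h.congr fun y ↦ ?_
    ring
  rw [integral_stdComplexGaussian_norm (fun y ↦ y ^ 2),
    integral_Ioi_of_hasDerivAt_of_tendsto (Continuous.continuousWithinAt (by fun_prop)) hd hi ht]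
  simp

/-- Size biasing increases the mean of the logarithm by one half. -/
lemma integral_norm_sq_mul_log :
    ∫ z : ℂ, ‖z‖ ^ 2 * Real.log ‖z‖ ∂stdComplexGaussian =
      (∫ z : ℂ, Real.log ‖z‖ ∂stdComplexGaussian) + 1 / 2 := by
  -- Integration by parts: `F` is a primitive of the difference of the two radial integrands, and `F
  -- 0 = -1/2` supplies the constant. Grouping `y * log y` gives continuity at 0.
  set F : ℝ → ℝ := fun y ↦ -(y * (y * Real.log y) * Real.exp (-y ^ 2)) -
    1 / 2 * Real.exp (-y ^ 2) with hF
  have hc : Continuous F := by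
    have := Real.continuous_mul_log
    fun_prop
  have hd : ∀ y ∈ Ioi (0 : ℝ), HasDerivAt F
      (2 * (y * ((y ^ 2 * Real.log y - Real.log y) * Real.exp (-y ^ 2)))) y := fun y hy ↦ by
    have hy0 : y ≠ 0 := ne_of_gt hy
    have h1 := (hasDerivAt_id y).mul ((hasDerivAt_id y).mul (Real.hasDerivAt_log hy0))
    refine ((h1.mul (hasDerivAt_exp_neg_sq y)).neg.sub
      ((hasDerivAt_exp_neg_sq y).const_mul (1 / 2))).congr_deriv ?_
    simp
    field_simp
    ring
  have hi : IntegrableOn (fun y : ℝ ↦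
      2 * (y * ((y ^ 2 * Real.log y - Real.log y) * Real.exp (-y ^ 2)))) (Ioi 0) := by
    refine (((integrableOn_pow_mul_log_mul_exp 2).sub
      (integrableOn_pow_mul_log_mul_exp 0)).const_mul 2).congr (.of_forall fun y ↦ ?_)
    simp
    ring
  have h0 : Tendsto (fun y : ℝ ↦ y * (y * Real.log y) * Real.exp (-y ^ 2)) atTop (𝓝 0) := by
    refine squeeze_zero' ?_ ?_ (tendsto_pow_mul_exp_neg_sq 2)
    · filter_upwards [eventually_ge_atTop 1] with y hy
      have := Real.log_nonneg hy
      positivity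
    · filter_upwards [eventually_ge_atTop 1] with y hy
      have h1 : Real.log y ≤ y ^ 2 := by
        have := Real.log_le_sub_one_of_pos (by linarith : 0 < y)
        nlinarith
      have : y * (y * Real.log y) ≤ (y ^ 2) ^ 2 := by nlinarith [sq_nonneg y]
      gcongr
  have ht : Tendsto F atTop (𝓝 0) := by
    have h := h0.neg.sub ((tendsto_pow_mul_exp_neg_sq 0).const_mul (1 / 2))
    simp only [pow_zero, one_mul, mul_zero, neg_zero, sub_zero] at h
    exact h
  rw [← sub_eq_iff_eq_add', ← integral_sub integrable_norm_sq_mul_log integrable_log_norm,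
    integral_stdComplexGaussian_norm (fun y ↦ y ^ 2 * Real.log y - Real.log y),
    integral_Ioi_of_hasDerivAt_of_tendsto hc.continuousWithinAt hd hi ht]
  simp [hF]

end EllipticEnergy

/-! ### The energy as a sum over zeros, and its expectation -/

namespace EllipticEnergy

open Polynomial

lemma sum_offDiag_eq {M : Type*} [AddCommMonoid M] (Z : Finset ℂ) (F : ℂ → ℂ → M) :
    ∑ p ∈ Z.offDiag, F p.1 p.2 = ∑ ζ ∈ Z, ∑ ξ ∈ Z.erase ζ, F ζ ξ :=
  Finset.sum_finset_product' _ _ _ fun p ↦ by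
    simp only [Finset.mem_offDiag, Finset.mem_erase]
    tauto

lemma log_sphericalDist {z w : ℂ} (h : z ≠ w) :
    Real.log (sphericalDist z w) = Real.log 2 + Real.log ‖z - w‖ -
      (1 / 2 * Real.log (1 + ‖z‖ ^ 2) + 1 / 2 * Real.log (1 + ‖w‖ ^ 2)) := by
  have h1 : ‖z - w‖ ≠ 0 := norm_ne_zero_iff.2 (sub_ne_zero.2 h)
  have h2 : Real.sqrt (1 + ‖z‖ ^ 2) ≠ 0 := (Real.sqrt_pos.2 (by positivity)).ne'
  have h3 : Real.sqrt (1 + ‖w‖ ^ 2) ≠ 0 := (Real.sqrt_pos.2 (by positivity)).ne'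
  rw [sphericalDist, Real.log_div (mul_ne_zero two_ne_zero h1) (mul_ne_zero h2 h3),
    Real.log_mul two_ne_zero h1, Real.log_mul h2 h3, Real.log_sqrt (by positivity),
    Real.log_sqrt (by positivity)]
  ring

/-- The logarithmic energy as a sum over the zeros. -/
lemma logEnergy_zeroSet {n : ℕ} {a : Fin (n + 1) → ℂ} (ha : a ∈ goodSet n) :
    logEnergy (zeroSet (ellipticPoly n a)) =
      -(n * (n - 1) * Real.log 2) + n * Real.log ‖a (Fin.last n)‖ -
        ∑ ζ ∈ zeroSet (ellipticPoly n a),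
          (Real.log ‖(derivative (ellipticPoly n a)).eval ζ‖ -
            (n - 1) * Real.log (1 + ‖ζ‖ ^ 2)) := by
  set Z := zeroSet (ellipticPoly n a) with hZ
  have hcard : (Z.card : ℝ) = n := by exact_mod_cast ha.2
  -- The weights of the other zeros are written as the full sum minus the own term; after summing
  -- over `ζ`, each `1/2 log (1+|ζ|²)` has been counted `2(n-1)` times.
  have hinner : ∀ ζ ∈ Z, ∑ ξ ∈ Z.erase ζ, Real.log (sphericalDist ζ ξ) =
      (n - 1) * Real.log 2 + (Real.log ‖(derivative (ellipticPoly n a)).eval ζ‖ -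
        Real.log ‖a (Fin.last n)‖) - ((n - 1) * (1 / 2 * Real.log (1 + ‖ζ‖ ^ 2)) +
        (∑ ξ ∈ Z, 1 / 2 * Real.log (1 + ‖ξ‖ ^ 2) - 1 / 2 * Real.log (1 + ‖ζ‖ ^ 2))) := by
    intro ζ hζ
    have hc : ((Z.erase ζ).card : ℝ) = n - 1 := by
      rw [← hcard, ← Finset.card_erase_add_one hζ]
      push_cast
      ring
    have hprod : Real.log ‖(derivative (ellipticPoly n a)).eval ζ‖ =
        Real.log ‖a (Fin.last n)‖ + ∑ ξ ∈ Z.erase ζ, Real.log ‖ζ - ξ‖ := by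
      have hne : ∀ ξ ∈ Z.erase ζ, ‖ζ - ξ‖ ≠ 0 := fun ξ hξ ↦
        norm_ne_zero_iff.2 (sub_ne_zero.2 (Finset.ne_of_mem_erase hξ).symm)
      rw [eval_derivative_ellipticPoly_root ha hζ, norm_mul, norm_prod,
        Real.log_mul (norm_ne_zero_iff.2 ha.1) (Finset.prod_ne_zero_iff.2 hne), Real.log_prod hne]
    rw [Finset.sum_congr rfl fun ξ hξ ↦ log_sphericalDist (Finset.ne_of_mem_erase hξ).symm,
      Finset.sum_sub_distrib, Finset.sum_add_distrib, Finset.sum_add_distrib, Finset.sum_const,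
      Finset.sum_const, nsmul_eq_mul, nsmul_eq_mul, hc, hprod,
      ← Finset.add_sum_erase Z (fun ξ ↦ 1 / 2 * Real.log (1 + ‖ξ‖ ^ 2)) hζ]
    ring
  rw [logEnergy, sum_offDiag_eq Z fun z w ↦ Real.log (sphericalDist z w),
    Finset.sum_congr rfl hinner]
  simp only [Finset.sum_sub_distrib, Finset.sum_add_distrib, Finset.sum_const, nsmul_eq_mul, hcard,
    ← Finset.mul_sum]
  ring

/-- The Kac–Rice formula for integrable real functions. -/
lemma integral_zeroSum {m : ℕ} {h : ℂ × ℂ → ℝ} (hm : Measurable h)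
    (hi : Integrable (fun x ↦ h (x.1, derivDev (m + 1) x.1 * x.2)) (zeroIntensity (m + 1))) :
    Integrable (fun a : Fin (m + 2) → ℂ ↦ ∑ ζ ∈ zeroSet (ellipticPoly (m + 1) a),
        h (ζ, (derivative (ellipticPoly (m + 1) a)).eval ζ))
        (Measure.pi fun _ ↦ stdComplexGaussian) ∧
      ∫ a : Fin (m + 2) → ℂ, ∑ ζ ∈ zeroSet (ellipticPoly (m + 1) a),
        h (ζ, (derivative (ellipticPoly (m + 1) a)).eval ζ)
        ∂Measure.pi (fun _ ↦ stdComplexGaussian) =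
      ∫ x, h (x.1, derivDev (m + 1) x.1 * x.2) ∂zeroIntensity (m + 1) := by
  -- The formula for nonnegative functions gives that for the positive part of `k`; it is then used
  -- for `h` and `-h`.
  have key : ∀ k : ℂ × ℂ → ℝ, Measurable k →
      Integrable (fun x ↦ k (x.1, derivDev (m + 1) x.1 * x.2)) (zeroIntensity (m + 1)) →
      Integrable (fun a : Fin (m + 2) → ℂ ↦ (zeroSum (fun x ↦ ENNReal.ofReal (k x)) a).toReal)
        (Measure.pi fun _ ↦ stdComplexGaussian) ∧
      ∫ a : Fin (m + 2) → ℂ, (zeroSum (fun x ↦ ENNReal.ofReal (k x)) a).toReal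
        ∂Measure.pi (fun _ ↦ stdComplexGaussian) =
      (∫⁻ x, ENNReal.ofReal (k (x.1, derivDev (m + 1) x.1 * x.2))
        ∂zeroIntensity (m + 1)).toReal := by
    intro k hk hki
    have hK : Measurable fun x ↦ ENNReal.ofReal (k x) := hk.ennreal_ofReal
    have hL := lintegral_zeroSum (m := m) hK
    have hae : AEMeasurable (zeroSum (n := m + 1) fun x ↦ ENNReal.ofReal (k x))
        (Measure.pi fun _ ↦ stdComplexGaussian) := by
      refine ⟨_, measurable_indicator_zeroSum hK, ?_⟩
      filter_upwards [mem_goodSet_ae m] with a ha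
      rw [Set.indicator_of_mem ha]
    have hfin : ∫⁻ x, ENNReal.ofReal (k (x.1, derivDev (m + 1) x.1 * x.2))
        ∂zeroIntensity (m + 1) ≠ ⊤ := hki.lintegral_lt_top.ne
    rw [← hL] at hfin
    refine ⟨integrable_toReal_of_lintegral_ne_top hae hfin, ?_⟩
    rw [integral_toReal hae (ae_lt_top' hae hfin), hL]
  have hdec : ∀ a : Fin (m + 2) → ℂ, ∑ ζ ∈ zeroSet (ellipticPoly (m + 1) a),
      h (ζ, (derivative (ellipticPoly (m + 1) a)).eval ζ) =
      (zeroSum (fun x ↦ ENNReal.ofReal (h x)) a).toReal -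
        (zeroSum (fun x ↦ ENNReal.ofReal (-h x)) a).toReal := by
    intro a
    rw [zeroSum, zeroSum, ENNReal.toReal_sum fun _ _ ↦ ENNReal.ofReal_ne_top,
      ENNReal.toReal_sum fun _ _ ↦ ENNReal.ofReal_ne_top, ← Finset.sum_sub_distrib]
    refine Finset.sum_congr rfl fun ζ _ ↦ ?_
    rw [ENNReal.toReal_ofReal', ENNReal.toReal_ofReal', max_zero_sub_eq_self]
  obtain ⟨hp, hp'⟩ := key h hm hi
  obtain ⟨hn, hn'⟩ := key (fun x ↦ -h x) hm.neg hi.neg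
  simp_rw [hdec]
  refine ⟨hp.sub hn, ?_⟩
  rw [integral_sub hp hn, hp', hn', integral_eq_lintegral_pos_part_sub_lintegral_neg_part hi]

/-- The density of the zeros, as a measure on the plane. -/
noncomputable def zeroDensity (n : ℕ) : Measure ℂ :=
  volume.withDensity fun z : ℂ ↦ ENNReal.ofReal (n * (Real.pi⁻¹ * ((1 + ‖z‖ ^ 2) ^ 2)⁻¹))

/-- The size-biased complex Gaussian law. -/
noncomputable def sizeBiasedGaussian : Measure ℂ :=
  stdComplexGaussian.withDensity fun g ↦ ENNReal.ofReal (‖g‖ ^ 2)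

lemma zeroIntensity_eq (n : ℕ) :
    zeroIntensity n = (zeroDensity n).prod sizeBiasedGaussian := rfl

lemma measurable_zeroDensity (n : ℕ) : Measurable fun z : ℂ ↦
    ENNReal.ofReal (n * (Real.pi⁻¹ * ((1 + ‖z‖ ^ 2) ^ 2)⁻¹)) := by
  fun_prop

lemma measurable_ofReal_norm_sq : Measurable fun g : ℂ ↦ ENNReal.ofReal (‖g‖ ^ 2) := by
  fun_prop

lemma integrable_zeroDensity {n : ℕ} {f : ℂ → ℝ}
    (hf : Integrable fun z : ℂ ↦ Real.pi⁻¹ * ((1 + ‖z‖ ^ 2) ^ 2)⁻¹ * f z) :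
    Integrable f (zeroDensity n) := by
  rw [zeroDensity, integrable_withDensity_iff_integrable_smul' (measurable_zeroDensity n)
    (.of_forall fun _ ↦ ENNReal.ofReal_lt_top)]
  refine (hf.const_mul (n : ℝ)).congr (.of_forall fun z ↦ ?_)
  simp only [smul_eq_mul]
  rw [ENNReal.toReal_ofReal (by positivity)]
  ring

lemma integral_zeroDensity (n : ℕ) (f : ℂ → ℝ) :
    ∫ z, f z ∂zeroDensity n = n * ∫ z : ℂ, Real.pi⁻¹ * ((1 + ‖z‖ ^ 2) ^ 2)⁻¹ * f z := by
  rw [zeroDensity, integral_withDensity_eq_integral_toReal_smul (measurable_zeroDensity n)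
    (.of_forall fun _ ↦ ENNReal.ofReal_lt_top), ← integral_const_mul]
  refine integral_congr_ae (.of_forall fun z ↦ ?_)
  simp only [smul_eq_mul]
  rw [ENNReal.toReal_ofReal (by positivity)]
  ring

lemma integrable_sizeBiasedGaussian {f : ℂ → ℝ}
    (hf : Integrable (fun z : ℂ ↦ ‖z‖ ^ 2 * f z) stdComplexGaussian) :
    Integrable f sizeBiasedGaussian := by
  rw [sizeBiasedGaussian, integrable_withDensity_iff_integrable_smul' measurable_ofReal_norm_sq
    (by simp)]
  refine hf.congr (.of_forall fun z ↦ ?_)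
  simp only [smul_eq_mul]
  rw [ENNReal.toReal_ofReal (by positivity)]

lemma integral_sizeBiasedGaussian (f : ℂ → ℝ) :
    ∫ z, f z ∂sizeBiasedGaussian = ∫ z : ℂ, ‖z‖ ^ 2 * f z ∂stdComplexGaussian := by
  rw [sizeBiasedGaussian, integral_withDensity_eq_integral_toReal_smul measurable_ofReal_norm_sq
    (by simp)]
  refine integral_congr_ae (.of_forall fun z ↦ ?_)
  simp only [smul_eq_mul]
  rw [ENNReal.toReal_ofReal (by positivity)]

instance (n : ℕ) : IsFiniteMeasure (zeroDensity n) := by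
  have h : Integrable (fun _ ↦ (1 : ℝ)) (zeroDensity n) :=
    integrable_zeroDensity (by simpa using sphere_mass.1)
  simpa [integrable_const_iff] using h

instance : IsFiniteMeasure sizeBiasedGaussian := by
  have h : Integrable (fun _ ↦ (1 : ℝ)) sizeBiasedGaussian :=
    integrable_sizeBiasedGaussian (by simpa using integrable_norm_sq)
  simpa [integrable_const_iff] using h

lemma zeroDensity_real_univ (n : ℕ) : (zeroDensity n).real Set.univ = n := by
  have h := integral_zeroDensity n fun _ ↦ 1
  simpa only [integral_const, smul_eq_mul, mul_one, sphere_mass.2] using h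

lemma sizeBiasedGaussian_real_univ : sizeBiasedGaussian.real Set.univ = 1 := by
  have h := integral_sizeBiasedGaussian fun _ ↦ 1
  simpa only [integral_const, smul_eq_mul, mul_one, integral_norm_sq] using h

/-- Taking logarithms separates `g` from `z`; the coefficient of `log (1+|z|²)` is `n/2 - 1 - (n-1)
= -n/2`. -/
lemma log_norm_derivDev_mul {n : ℕ} (hn : n ≠ 0) (z : ℂ) {g : ℂ} (hg : g ≠ 0) :
    Real.log ‖derivDev n z * g‖ - (n - 1) * Real.log (1 + ‖z‖ ^ 2) =
      Real.log ‖g‖ + (1 / 2 * Real.log n - n / 2 * Real.log (1 + ‖z‖ ^ 2)) := by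
  have hr : 0 < 1 + ‖z‖ ^ 2 := by positivity
  have hn' : (0 : ℝ) < n := by exact_mod_cast Nat.pos_of_ne_zero hn
  have hs : 0 < Real.sqrt (n * (1 + ‖z‖ ^ 2) ^ n) := Real.sqrt_pos.2 (by positivity)
  have hd : 0 < derivDev n z := div_pos hs hr
  rw [norm_mul, Complex.norm_of_nonneg hd.le, Real.log_mul hd.ne' (norm_ne_zero_iff.2 hg),
    derivDev, Real.log_div hs.ne' hr.ne', Real.log_sqrt (by positivity),
    Real.log_mul hn'.ne' (by positivity), Real.log_pow]
  ring

lemma integral_log_derivative {n : ℕ} (hn : n ≠ 0) :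
    Integrable (fun x : ℂ × ℂ ↦ Real.log ‖derivDev n x.1 * x.2‖ -
        (n - 1) * Real.log (1 + ‖x.1‖ ^ 2)) (zeroIntensity n) ∧
      ∫ x : ℂ × ℂ, (Real.log ‖derivDev n x.1 * x.2‖ -
        (n - 1) * Real.log (1 + ‖x.1‖ ^ 2)) ∂zeroIntensity n =
      n * ((∫ g, Real.log ‖g‖ ∂stdComplexGaussian) + 1 / 2 + 1 / 2 * Real.log n - n / 2) := by
  have hae : (fun x : ℂ × ℂ ↦ Real.log ‖derivDev n x.1 * x.2‖ -
      (n - 1) * Real.log (1 + ‖x.1‖ ^ 2)) =ᵐ[(zeroDensity n).prod sizeBiasedGaussian]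
      fun x ↦ Real.log ‖x.2‖ + (1 / 2 * Real.log n - n / 2 * Real.log (1 + ‖x.1‖ ^ 2)) := by
    have h0 : ∀ᵐ g ∂sizeBiasedGaussian, g ≠ 0 :=
      ((withDensity_absolutelyContinuous _ _).trans
        stdComplexGaussian_absolutelyContinuous).ae_le (Measure.ae_ne volume 0)
    filter_upwards [Measure.quasiMeasurePreserving_snd.ae h0] with x hx
    exact log_norm_derivDev_mul hn x.1 hx
  have h1 : Integrable (fun x : ℂ × ℂ ↦ Real.log ‖x.2‖)
      ((zeroDensity n).prod sizeBiasedGaussian) :=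
    (integrable_sizeBiasedGaussian integrable_norm_sq_mul_log).comp_snd _
  have h2 : Integrable (fun z : ℂ ↦ 1 / 2 * Real.log n - n / 2 * Real.log (1 + ‖z‖ ^ 2))
      (zeroDensity n) :=
    (integrable_const _).sub ((integrable_zeroDensity sphere_log_potential.1).const_mul _)
  have h3 := h2.comp_fst sizeBiasedGaussian
  rw [zeroIntensity_eq]
  refine ⟨(h1.add h3).congr hae.symm, ?_⟩
  rw [integral_congr_ae hae, integral_add h1 h3,
    integral_fun_snd (fun g : ℂ ↦ Real.log ‖g‖),
    integral_fun_fst (fun z : ℂ ↦ 1 / 2 * Real.log n - n / 2 * Real.log (1 + ‖z‖ ^ 2)),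
    zeroDensity_real_univ, sizeBiasedGaussian_real_univ, integral_sizeBiasedGaussian,
    integral_norm_sq_mul_log, integral_sub (integrable_const _)
      ((integrable_zeroDensity sphere_log_potential.1).const_mul _), integral_const,
    integral_const_mul, integral_zeroDensity, sphere_log_potential.2, zeroDensity_real_univ]
  simp only [smul_eq_mul]
  ring

/-- The expected energy for independent Gaussian coefficients on the canonical space. -/
lemma integral_logEnergy_pi (m : ℕ) :
    Integrable (fun a : Fin (m + 2) → ℂ ↦ logEnergy (zeroSet (ellipticPoly (m + 1) a)))
        (Measure.pi fun _ ↦ stdComplexGaussian) ∧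
      ∫ a : Fin (m + 2) → ℂ, logEnergy (zeroSet (ellipticPoly (m + 1) a))
        ∂Measure.pi (fun _ ↦ stdComplexGaussian) =
      (1 / 2 - Real.log 2) * ((m + 1 : ℕ) : ℝ) ^ 2 -
        1 / 2 * ((m + 1 : ℕ) : ℝ) * Real.log (m + 1 : ℕ) -
        (1 / 2 - Real.log 2) * ((m + 1 : ℕ) : ℝ) := by
  set ν := Measure.pi fun _ : Fin (m + 2) ↦ stdComplexGaussian with hν
  obtain ⟨hi, hv⟩ := integral_log_derivative (n := m + 1) m.succ_ne_zero
  obtain ⟨hS, hS'⟩ := integral_zeroSum (m := m)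
    (h := fun x ↦ Real.log ‖x.2‖ - (((m + 1 : ℕ) : ℝ) - 1) * Real.log (1 + ‖x.1‖ ^ 2))
    (by fun_prop) hi
  simp only at hS hS'
  have hae := (mem_goodSet_ae m).mono fun a ha ↦ logEnergy_zeroSet ha
  have hmp := measurePreserving_eval (fun _ : Fin (m + 2) ↦ stdComplexGaussian) (Fin.last (m + 1))
  have hL : Integrable (fun a : Fin (m + 2) → ℂ ↦ Real.log ‖a (Fin.last (m + 1))‖) ν :=
    hmp.integrable_comp_of_integrable integrable_log_norm
  -- The mean of `log |g|` is left unevaluated: it also occurs in `hv`, and the two contributions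
  -- cancel.
  have hL' : ∫ a : Fin (m + 2) → ℂ, Real.log ‖a (Fin.last (m + 1))‖ ∂ν =
      ∫ g, Real.log ‖g‖ ∂stdComplexGaussian := by
    rw [← hmp.map_eq, integral_map hmp.aemeasurable
      (Measurable.aestronglyMeasurable (by fun_prop))]
  have hC : Integrable (fun a : Fin (m + 2) → ℂ ↦
      -(((m + 1 : ℕ) : ℝ) * (((m + 1 : ℕ) : ℝ) - 1) * Real.log 2) +
        ((m + 1 : ℕ) : ℝ) * Real.log ‖a (Fin.last (m + 1))‖) ν :=
    (integrable_const _).add (hL.const_mul _)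
  refine ⟨(hC.sub hS).congr (hae.mono fun a h ↦ h.symm), ?_⟩
  refine ((integral_congr_ae hae).trans (integral_sub hC hS)).trans ?_
  rw [integral_add (integrable_const _) (hL.const_mul _), integral_const_mul, hL', hS', hv]
  simp only [integral_const, probReal_univ, smul_eq_mul]
  ring

end EllipticEnergy

theorem lemma2p5 {Ω : Type*} [MeasurableSpace Ω] (P : Measure Ω) [IsProbabilityMeasure P]
    (n : ℕ) (hn : 1 ≤ n) (a : Fin (n + 1) → Ω → ℂ)
    (hlaw : ∀ j, HasLaw (a j) EllipticEnergy.stdComplexGaussian P) (hindep : iIndepFun a P) :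
    (∀ᵐ ω ∂P,
      (EllipticEnergy.zeroSet (EllipticEnergy.ellipticPoly n fun j ↦ a j ω)).card = n) ∧
    Integrable (fun ω ↦ EllipticEnergy.logEnergy
      (EllipticEnergy.zeroSet (EllipticEnergy.ellipticPoly n fun j ↦ a j ω))) P ∧
    ∫ ω, EllipticEnergy.logEnergy
      (EllipticEnergy.zeroSet (EllipticEnergy.ellipticPoly n fun j ↦ a j ω)) ∂P
      = (1 / 2 - Real.log 2) * (n : ℝ) ^ 2 - 1 / 2 * (n : ℝ) * Real.log n
        - (1 / 2 - Real.log 2) * (n : ℝ) := by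
  open EllipticEnergy in
  obtain ⟨m, rfl⟩ := Nat.exists_eq_add_of_le' hn
  have ham : AEMeasurable (fun ω j ↦ a j ω) P :=
    aemeasurable_pi_lambda _ fun j ↦ (hlaw j).aemeasurable
  -- Independence and the marginal laws determine the joint law, through which all three claims
  -- transfer from the product space.
  have hmap : P.map (fun ω j ↦ a j ω) = Measure.pi fun _ ↦ stdComplexGaussian := by
    rw [(iIndepFun_iff_map_fun_eq_pi_map fun j ↦ (hlaw j).aemeasurable).1 hindep]
    simp_rw [fun j ↦ (hlaw j).map_eq]
  obtain ⟨hi, hv⟩ := integral_logEnergy_pi m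
  have hgood := mem_goodSet_ae m
  rw [← hmap] at hi hv hgood
  refine ⟨?_, hi.comp_aemeasurable ham, ?_⟩
  · filter_upwards [ae_of_ae_map ham hgood] with ω hω
    exact hω.2
  · rw [← hv, integral_map ham hi.1]
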